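/- Identify $\mathbb{R}^2$ with $\mathbb{C}$ and let $\mathcal{H}^1$ be the one-dimensional Hausdorff measure. The Painlevé length $\kappa(K)$ of a compact set $K\subset\mathbb{R}^2$ is the infimum of the numbers $\ell$ with the following property: for every open set $U\supset K$ there is an open set $V$ with $K\subset V\subset U$ such that $\partial V$ is a finite union of pairwise disjoint analytic Jordan curves of total length at most $\ell$. For integers $k\ge 2$ and $1\le j\le 2^k$ let $$f_{k,j}(z) = 2^{-k}z + (1-2^{-k})\,e^{j2^{1-k}\pi i}.$$ Let $K_1=\overline{B}(0,1)$ be the closed unit disc, for $k\ge 2$ let $$K_k=\bigcup_{(j_2,\dots,j_k)} f_{2,j_2}\circ f_{3,j_3}\circ\cdots\circ f_{k,j_k}(K_1),$$ where the union is over all tuples with $1\le j_i\le 2^i$ for $i=2,\dots,k$, and let $K=\bigcap_{k\ge 1}K_k$. Then $K_{k+1}\subset K_k$ for every $k\ge 1$, the set $K$ is compact and totally disconnected, $\mathcal{H}^1(K)=2$ and $\kappa(K)=2\pi$. Hence $\kappa(K)=\pi\,\mathcal{H}^1(K)$, so the constant $\pi$ in the general bound $\kappa(E)\le\pi\,\mathcal{H}^1(E)$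 for compact $E\subset\mathbb{R}^2$ is sharp: if $c\in[0,\infty]$ satisfies $\kappa(E)\le c\,\mathcal{H}^1(E)$ for every compact $E\subset\mathbb{R}^2$, then $c\ge\pi$. -/

import Mathlib

open MeasureTheory Set

open scoped ENNReal Real

namespace Painleve

/-- `γ` is a regular real-analytic parametrisation, of period `1`, of an analytic Jordan curve
in the plane `ℂ = ℝ²`; the curve itself is `range γ`. -/
structure IsAnalyticJordanCurve (γ : ℝ → ℂ) : Prop where
  analytic : AnalyticOnNhd ℝ γ univ
  periodic : Function.Periodic γ 1
  injOn : InjOn γ (Ico 0 1)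
  regular : ∀ t, deriv γ t ≠ 0

/-- The length of the closed curve `γ` of period `1`: the supremum of the lengths of inscribed
polygonal lines over one period. -/
noncomputable def curveLength (γ : ℝ → ℂ) : ℝ≥0∞ := eVariationOn γ (Icc 0 1)

/-- The boundary of `V` is a finite union of disjoint analytic Jordan curves of total length at
most `l`. -/
def HasAnalyticBoundaryOfLengthLE (V : Set ℂ) (l : ℝ≥0∞) : Prop :=
  ∃ (n : ℕ) (γ : Fin n → ℝ → ℂ),
    (∀ i, IsAnalyticJordanCurve (γ i)) ∧
    (∀ i j, i ≠ j → Disjoint (range (γ i)) (range (γ j))) ∧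
    frontier V = ⋃ i, range (γ i) ∧
    ∑ i, curveLength (γ i) ≤ l

/-- The Painlevé length `κ(K)` of a (compact) planar set `K`. -/
noncomputable def kappa (K : Set ℂ) : ℝ≥0∞ :=
  sInf {l : ℝ≥0∞ | ∀ U : Set ℂ, IsOpen U → K ⊆ U →
    ∃ V : Set ℂ, IsOpen V ∧ K ⊆ V ∧ V ⊆ U ∧ HasAnalyticBoundaryOfLengthLE V l}

/-- The similitude `f_{k,j}(z) = 2⁻ᵏ z + (1 - 2⁻ᵏ) exp(j 2^{1-k} π i)`. -/
noncomputable def f (k j : ℕ) (z : ℂ) : ℂ :=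
  (1 / 2 ^ k) * z + (1 - 1 / 2 ^ k) * Complex.exp (j * (2 / 2 ^ k) * π * Complex.I)

/-- `wordMap j k = f_{2,j₂} ∘ f_{3,j₃} ∘ ⋯ ∘ f_{k,j_k}`, which is the identity for `k ≤ 1`.
Only the values `j i` with `2 ≤ i ≤ k` matter. -/
noncomputable def wordMap (j : ℕ → ℕ) : ℕ → ℂ → ℂ
  | 0 => id
  | 1 => id
  | k + 2 => wordMap j (k + 1) ∘ f (k + 2) (j (k + 2))

/-- The union `K_k` of the construction balls of level `k` (used for `k ≥ 1`). -/
noncomputable def level (k : ℕ) : Set ℂ :=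
  ⋃ j ∈ {j : ℕ → ℕ | ∀ i, 2 ≤ i → i ≤ k → 1 ≤ j i ∧ j i ≤ 2 ^ i},
    wordMap j k '' Metric.closedBall 0 1

/-- The "circles of balls" set `K = ⋂_{k ≥ 1} K_k`. -/
noncomputable def circlesOfBalls : Set ℂ := ⋂ k ∈ {k : ℕ | 1 ≤ k}, level k

end Painleve

namespace Painleve

open Bornology Metric

/-! A ball of level `k` has `2 ^ (k + 1)` children, each `2 ^ (k + 1)` times smaller, so the radii
of each level add up to `1`. Covering by the balls of one level gives `μH[1] K ≤ 2`, and slightly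
larger circles give `κ(K) ≤ 2π`.

Both lower bounds rest on `mass_le_hullPerimeter`: if `A` has small diameter, the perimeter of its
convex hull is at least nearly `2π` times the proportion of the construction balls that `A`
contains. Perimeter means the integral of the support function (Cauchy's formula). In this form it
is monotone, subadditive on sets that meet, at most `π` times the diameter, and at most the length
of a closed curve through the set.

The estimate goes by induction over the tree of balls. If `A` has mass in only one child, use the
induction hypothesis there. If it has mass in `m ≥ 2` children but in at most half of them, two of
these are about `π (m - 1)` child radii or more apart (`exists_far_pair`); the hull pays for both
pieces and for twice their distance, which covers the full mass of the other `m - 2` children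
(`hullPerimeter_add_le`). If more than half are involved, the support function is nearly that of the
parent disc on a proportional set of directions (`le_hullPerimeter_of_many`). The loss factor does
not accumulate: the last case does not use the induction hypothesis, and the others pass the factor
on unchanged.

For the measure, sum perimeter `≤ π * diam` over a cover: `2π ≤ π * ∑ diam` in the limit. For `κ`,
merge the hulls of the boundary curves of `V` into disjoint convex sets without increasing perimeter
(`exists_disjoint_convex_cover`). These contain `V` (`subset_biUnion_of_frontier_subset`), hence all
balls of a deep level, so their perimeters, and with them the lengths of the curves, add up to
nearly `2π`. -/

section HullPerimeter

/-! ### Support functions, widths and the perimeter of the convex hull -/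

/-- The orthogonal projection of `z` to the oriented line of direction `exp (θ I)`. -/
noncomputable def proj (θ : ℝ) : ℂ →ₗ[ℝ] ℝ where
  toFun z := z.re * Real.cos θ + z.im * Real.sin θ
  map_add' z w := by simp; ring
  map_smul' c z := by simp; ring

lemma proj_apply (θ : ℝ) (z : ℂ) : proj θ z = z.re * Real.cos θ + z.im * Real.sin θ := rfl

lemma proj_eq (θ : ℝ) (z : ℂ) : proj θ z = ‖z‖ * Real.cos (θ - z.arg) := by
  rw [Real.cos_sub, proj_apply]
  conv_lhs => rw [← Complex.norm_mul_cos_arg z, ← Complex.norm_mul_sin_arg z]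
  ring

lemma abs_proj_le (θ : ℝ) (z : ℂ) : |proj θ z| ≤ ‖z‖ := by
  rw [proj_eq, abs_mul, abs_norm]
  exact mul_le_of_le_one_right (norm_nonneg z) (Real.abs_cos_le_one _)

lemma proj_le (θ : ℝ) (z : ℂ) : proj θ z ≤ ‖z‖ := (le_abs_self _).trans (abs_proj_le θ z)

lemma proj_add_pi (θ : ℝ) (z : ℂ) : proj (θ + π) z = -proj θ z := by
  simp [proj_apply]; ring

lemma proj_add_two_pi (θ : ℝ) (z : ℂ) : proj (θ + 2 * π) z = proj θ z := by
  simp [proj_apply]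

lemma proj_mul_exp (θ r φ : ℝ) :
    proj θ (r * Complex.exp (φ * Complex.I)) = r * Real.cos (θ - φ) := by
  rw [proj_apply, Complex.re_ofReal_mul, Complex.im_ofReal_mul, Complex.exp_ofReal_mul_I_re,
    Complex.exp_ofReal_mul_I_im, Real.cos_sub]
  ring

lemma continuous_proj_left (z : ℂ) : Continuous fun θ => proj θ z := by
  simp only [proj_apply]; fun_prop

lemma continuous_proj (θ : ℝ) : Continuous (proj θ) := by
  change Continuous fun z => proj θ z
  simp only [proj_apply]; fun_prop

lemma integral_proj (z : ℂ) : ∫ θ in (0)..(2 * π), proj θ z = 0 := by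
  simp only [proj_apply]
  rw [intervalIntegral.integral_add (by apply Continuous.intervalIntegrable; fun_prop)
    (by apply Continuous.intervalIntegrable; fun_prop)]
  simp

lemma integral_abs_cos : ∫ θ in (0)..(2 * π), |Real.cos θ| = 4 := by
  have hc : Continuous fun θ => |Real.cos θ| := by fun_prop
  have hi : ∀ a b, IntervalIntegrable (fun θ => |Real.cos θ|) volume a b :=
    fun a b => hc.intervalIntegrable a b
  have hp : Function.Periodic (fun θ => |Real.cos θ|) π := fun θ => by
    simp [Real.cos_add_pi]
  have h1 : ∫ θ in (-(π / 2))..(-(π / 2) + π), |Real.cos θ| = 2 := by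
    have : ∫ θ in (-(π / 2))..(π / 2), |Real.cos θ| = ∫ θ in (-(π / 2))..(π / 2), Real.cos θ := by
      apply intervalIntegral.integral_congr
      intro θ hθ
      rw [uIcc_of_le (by linarith [Real.pi_pos])] at hθ
      exact abs_of_nonneg (Real.cos_nonneg_of_mem_Icc hθ)
    rw [show -(π / 2) + π = π / 2 by ring, this, integral_cos]
    simp; norm_num
  have h2 : ∫ θ in (0)..π, |Real.cos θ| = 2 := by
    have := hp.intervalIntegral_add_eq (-(π / 2)) 0
    rw [h1, zero_add] at this
    exact this.symm
  have h3 : ∫ θ in π..(2 * π), |Real.cos θ| = 2 := by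
    have := hp.intervalIntegral_add_eq 0 π
    rw [zero_add, h2] at this
    rw [two_mul]; exact this.symm
  rw [← intervalIntegral.integral_add_adjacent_intervals (hi 0 π) (hi π (2 * π)), h2, h3]
  norm_num

/-- The Cauchy–Crofton constant, which turns averages of projected lengths into lengths. -/
lemma integral_abs_proj (z : ℂ) : ∫ θ in (0)..(2 * π), |proj θ z| = 4 * ‖z‖ := by
  simp only [proj_eq, abs_mul, abs_norm]
  rw [intervalIntegral.integral_const_mul,
    intervalIntegral.integral_comp_sub_right (fun θ => |Real.cos θ|)]
  have hp : Function.Periodic (fun θ => |Real.cos θ|) (2 * π) := fun θ => by simp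
  have := hp.intervalIntegral_add_eq (0 - z.arg) 0
  rw [zero_add, integral_abs_cos] at this
  rw [show 2 * π - z.arg = 0 - z.arg + 2 * π by ring, this]
  ring

/-- The support function of a planar set. -/
noncomputable def support (A : Set ℂ) (θ : ℝ) : ℝ := sSup (proj θ '' A)

/-- The integral of the support function over all directions. By Cauchy's formula this is the
perimeter of the convex hull. -/
noncomputable def hullPerimeter (A : Set ℂ) : ℝ := ∫ θ in (0)..(2 * π), support A θ

variable {A B : Set ℂ}

lemma bddAbove_proj_image (hA : IsBounded A) (θ : ℝ) : BddAbove (proj θ '' A) := by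
  obtain ⟨R, hR⟩ := hA.exists_norm_le
  refine ⟨R, ?_⟩
  rintro _ ⟨z, hz, rfl⟩
  exact (proj_le θ z).trans (hR z hz)

lemma proj_le_support (hA : IsBounded A) (θ : ℝ) {z : ℂ} (hz : z ∈ A) :
    proj θ z ≤ support A θ :=
  le_csSup (bddAbove_proj_image hA θ) (mem_image_of_mem _ hz)

lemma support_le (hA : A.Nonempty) {θ b : ℝ} (h : ∀ z ∈ A, proj θ z ≤ b) : support A θ ≤ b :=
  csSup_le (hA.image _) (by rintro _ ⟨z, hz, rfl⟩; exact h z hz)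

lemma support_add_two_pi (A : Set ℂ) (θ : ℝ) : support A (θ + 2 * π) = support A θ := by
  simp only [support, proj_add_two_pi]

lemma continuous_support (hA : IsBounded A) (hne : A.Nonempty) : Continuous (support A) := by
  obtain ⟨R, hR⟩ := hA.exists_norm_le
  have hR0 : 0 ≤ R := (norm_nonneg _).trans (hR _ hne.some_mem)
  have key : ∀ θ φ, support A θ ≤ support A φ + (2 * R) * |θ - φ| := fun θ φ => by
    apply support_le hne
    intro z hz
    have h1 := proj_le_support hA φ hz
    have h2 : proj θ z - proj φ z ≤ (2 * R) * |θ - φ| := by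
      have hc : |Real.cos θ - Real.cos φ| ≤ |θ - φ| := by
        simpa [Real.dist_eq] using Real.lipschitzWith_cos.dist_le_mul θ φ
      have hs : |Real.sin θ - Real.sin φ| ≤ |θ - φ| := by
        simpa [Real.dist_eq] using Real.lipschitzWith_sin.dist_le_mul θ φ
      calc proj θ z - proj φ z = z.re * (Real.cos θ - Real.cos φ)
            + z.im * (Real.sin θ - Real.sin φ) := by simp only [proj_apply]; ring
        _ ≤ |z.re| * |Real.cos θ - Real.cos φ| + |z.im| * |Real.sin θ - Real.sin φ| := by
            rw [← abs_mul, ← abs_mul]; exact add_le_add (le_abs_self _) (le_abs_self _)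
        _ ≤ R * |θ - φ| + R * |θ - φ| := by
            gcongr
            · exact (Complex.abs_re_le_norm z).trans (hR z hz)
            · exact (Complex.abs_im_le_norm z).trans (hR z hz)
        _ = _ := by ring
    linarith
  refine (LipschitzWith.of_dist_le_mul (K := ⟨2 * R, by positivity⟩) fun θ φ => ?_).continuous
  rw [Real.dist_eq, Real.dist_eq, abs_le]
  constructor
  · have := key φ θ
    rw [abs_sub_comm] at this
    change -(2 * R * |θ - φ|) ≤ _
    linarith
  · change _ ≤ 2 * R * |θ - φ|
    linarith [key θ φ]

lemma intervalIntegrable_support (hA : IsBounded A) (hne : A.Nonempty) (a b : ℝ) :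
    IntervalIntegrable (support A) volume a b :=
  (continuous_support hA hne).intervalIntegrable a b

/-- The width of a planar set in a direction. -/
noncomputable def width (A : Set ℂ) (θ : ℝ) : ℝ := support A θ + support A (θ + π)

lemma continuous_width (hA : IsBounded A) (hne : A.Nonempty) : Continuous (width A) :=
  (continuous_support hA hne).add ((continuous_support hA hne).comp (by fun_prop))

/-- Periodicity absorbs the shift by `π`. Widths are convenient because they only involve
differences of points of the set. -/
lemma two_mul_hullPerimeter (hA : IsBounded A) (hne : A.Nonempty) :
    2 * hullPerimeter A = ∫ θ in (0)..(2 * π), width A θ := by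
  have hc := continuous_support hA hne
  have hc' : Continuous fun θ => support A (θ + π) := hc.comp (continuous_add_const π)
  unfold width hullPerimeter
  rw [intervalIntegral.integral_add (hc.intervalIntegrable _ _)
    (hc'.intervalIntegrable _ _), two_mul]
  congr 1
  rw [intervalIntegral.integral_comp_add_right (support A)]
  have hp : Function.Periodic (support A) (2 * π) := support_add_two_pi A
  rw [← zero_add (2 * π), hp.intervalIntegral_add_eq 0 (0 + π)]
  congr 1; ring

lemma width_le (hne : A.Nonempty) {θ b : ℝ}
    (h : ∀ z ∈ A, ∀ w ∈ A, proj θ z - proj θ w ≤ b) : width A θ ≤ b := by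
  have h1 : support A θ ≤ b - support A (θ + π) := by
    apply support_le hne
    intro z hz
    have : support A (θ + π) ≤ b - proj θ z := by
      apply support_le hne
      intro w hw
      rw [proj_add_pi]
      linarith [h z hz w hw]
    linarith
  unfold width; linarith

lemma le_width (hA : IsBounded A) (θ : ℝ) {z w : ℂ} (hz : z ∈ A) (hw : w ∈ A) :
    proj θ z - proj θ w ≤ width A θ := by
  have h1 := proj_le_support hA θ hz
  have h2 := proj_le_support hA (θ + π) hw
  rw [proj_add_pi] at h2
  unfold width; linarith

lemma support_mono (hA : A.Nonempty) (hB : IsBounded B) (h : A ⊆ B) (θ : ℝ) :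
    support A θ ≤ support B θ :=
  support_le hA fun _ hz => proj_le_support hB θ (h hz)

lemma hullPerimeter_mono (hA : A.Nonempty) (hB : IsBounded B) (h : A ⊆ B) :
    hullPerimeter A ≤ hullPerimeter B :=
  intervalIntegral.integral_mono (by positivity)
    (intervalIntegrable_support (hB.subset h) hA _ _)
    (intervalIntegrable_support hB (hA.mono h) _ _) (support_mono hA hB h)

lemma hullPerimeter_nonneg (hA : IsBounded A) : 0 ≤ hullPerimeter A := by
  rcases A.eq_empty_or_nonempty with rfl | hne
  · simp [hullPerimeter, support]
  · have h := two_mul_hullPerimeter hA hne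
    have : 0 ≤ ∫ θ in (0)..(2 * π), width A θ :=
      intervalIntegral.integral_nonneg (by positivity) fun θ _ => by
        have := le_width hA θ hne.some_mem hne.some_mem
        linarith
    linarith

/-- The point of the disc in direction `θ` is a witness for the support function, and the
contribution of the centre integrates to zero. -/
lemma le_hullPerimeter_closedBall (c : ℂ) {r : ℝ} (hr : 0 ≤ r) :
    2 * π * r ≤ hullPerimeter (closedBall c r) := by
  have h1 : ∀ θ, proj θ c + r ≤ support (closedBall c r) θ := fun θ => by
    have hz : c + r * Complex.exp (θ * Complex.I) ∈ closedBall c r := by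
      rw [mem_closedBall, dist_eq_norm, add_sub_cancel_left, norm_mul,
        Complex.norm_exp_ofReal_mul_I, mul_one, Complex.norm_real, Real.norm_of_nonneg hr]
    have := proj_le_support isBounded_closedBall θ hz
    rwa [map_add, proj_mul_exp, sub_self, Real.cos_zero, mul_one] at this
  have hne : (closedBall c r).Nonempty := ⟨c, mem_closedBall_self hr⟩
  have hi : IntervalIntegrable (fun θ => proj θ c) volume 0 (2 * π) :=
    (continuous_proj_left c).intervalIntegrable _ _
  calc 2 * π * r = ∫ θ in (0)..(2 * π), (proj θ c + r) := by
        rw [intervalIntegral.integral_add hi (by simp), integral_proj]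
        simp
    _ ≤ _ := intervalIntegral.integral_mono (by positivity) (hi.add (by simp))
        (intervalIntegrable_support isBounded_closedBall hne _ _) h1

lemma hullPerimeter_le_of_width_le (hA : IsBounded A) (hne : A.Nonempty) {g : ℝ → ℝ}
    (hg : Continuous g) (h : ∀ θ, width A θ ≤ g θ) :
    2 * hullPerimeter A ≤ ∫ θ in (0)..(2 * π), g θ := by
  rw [two_mul_hullPerimeter hA hne]
  exact intervalIntegral.integral_mono (by positivity)
    ((continuous_width hA hne).intervalIntegrable _ _) (hg.intervalIntegrable _ _) h

/-- No width exceeds the diameter. Discs give equality, which is why `π` is the right constant. -/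
lemma hullPerimeter_le_pi_mul_diam (hA : IsBounded A) : hullPerimeter A ≤ π * diam A := by
  rcases A.eq_empty_or_nonempty with rfl | hne
  · simp [hullPerimeter, support]
  have := hullPerimeter_le_of_width_le hA hne (g := fun _ => diam A) continuous_const fun θ => by
    apply width_le hne
    intro z hz w hw
    rw [← map_sub]
    exact (proj_le θ _).trans ((dist_eq_norm z w).symm.le.trans (dist_le_diam_of_mem hA hz hw))
  simp at this
  linarith

/-- Both support functions are at least `proj θ x` at a common point `x`, so their maximum is at
most their sum minus `proj θ x`; that last term has integral zero. -/
lemma hullPerimeter_union_le (hA : IsBounded A) (hB : IsBounded B) (h : (A ∩ B).Nonempty) :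
    hullPerimeter (A ∪ B) ≤ hullPerimeter A + hullPerimeter B := by
  obtain ⟨x, hxA, hxB⟩ := h
  have hiA := intervalIntegrable_support hA ⟨x, hxA⟩ 0 (2 * π)
  have hiB := intervalIntegrable_support hB ⟨x, hxB⟩ 0 (2 * π)
  have hi : IntervalIntegrable (fun θ => proj θ x) volume 0 (2 * π) :=
    (continuous_proj_left x).intervalIntegrable _ _
  have hne : (A ∪ B).Nonempty := ⟨x, Or.inl hxA⟩
  calc hullPerimeter (A ∪ B)
      ≤ ∫ θ in (0)..(2 * π), (support A θ + support B θ - proj θ x) := by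
        refine intervalIntegral.integral_mono (by positivity)
          (intervalIntegrable_support (hA.union hB) hne _ _) ((hiA.add hiB).sub hi) fun θ => ?_
        apply support_le hne
        have h1 := proj_le_support hA θ hxA
        have h2 := proj_le_support hB θ hxB
        rintro z (hz | hz)
        · have := proj_le_support hA θ hz
          linarith
        · have := proj_le_support hB θ hz
          linarith
    _ = _ := by
        rw [intervalIntegral.integral_sub (hiA.add hiB) hi, intervalIntegral.integral_add hiA hiB,
          integral_proj, sub_zero]
        rfl

/-- A support function bounds a closed half-plane, and such half-planes survive convex hull and
closure. -/
lemma hullPerimeter_closure_convexHull_le (hA : IsBounded A) (hne : A.Nonempty) :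
    hullPerimeter (closure (convexHull ℝ A)) ≤ hullPerimeter A := by
  have hb : IsBounded (closure (convexHull ℝ A)) := (isBounded_convexHull.2 hA).closure
  have hne' : (closure (convexHull ℝ A)).Nonempty := hne.convexHull.closure
  refine intervalIntegral.integral_mono (by positivity) (intervalIntegrable_support hb hne' _ _)
    (intervalIntegrable_support hA hne _ _) fun θ => support_le hne' fun z hz => ?_
  have hcl : IsClosed {z | proj θ z ≤ support A θ} :=
    isClosed_le (continuous_proj θ) continuous_const
  have hco : Convex ℝ {z | proj θ z ≤ support A θ} :=
    convex_halfSpace_le (proj θ).isLinear _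
  exact closure_minimal (convexHull_min (fun w hw => proj_le_support hA θ hw) hco) hcl hz

/-- Two parts of a set that lie in discs of radius `ρ` with far apart centres both contribute to
the perimeter of the hull. -/
lemma hullPerimeter_add_le {A₁ A₂ : Set ℂ} (hA : IsBounded A) (h₁ : A₁ ⊆ A) (h₂ : A₂ ⊆ A)
    (hne₁ : A₁.Nonempty) (hne₂ : A₂.Nonempty) {c₁ c₂ : ℂ} {ρ : ℝ} (hc₁ : A₁ ⊆ closedBall c₁ ρ)
    (hc₂ : A₂ ⊆ closedBall c₂ ρ) :
    hullPerimeter A₁ + hullPerimeter A₂ + 2 * ‖c₂ - c₁‖ - 2 * π * ρ ≤ hullPerimeter A := by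
  have hb₁ := hA.subset h₁
  have hb₂ := hA.subset h₂
  -- With `A₂` in front, its front and the back of `A₁` bound the width of `A`. The two inner
  -- supports are controlled by the discs, and the gap between the centres is gained.
  have aux : ∀ {A₁ A₂ : Set ℂ} {c₁ c₂ : ℂ} (_ : A₁ ⊆ A) (_ : A₂ ⊆ A)
      (_ : A₁.Nonempty) (_ : A₂.Nonempty) (_ : A₁ ⊆ closedBall c₁ ρ)
      (_ : A₂ ⊆ closedBall c₂ ρ) (θ : ℝ),
      width A₁ θ + width A₂ θ + proj θ (c₂ - c₁) - 2 * ρ ≤ width A θ := by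
    intro A₁ A₂ c₁ c₂ h₁ h₂ hne₁ hne₂ hc₁ hc₂ θ
    have e1 : support A₁ θ ≤ proj θ c₁ + ρ := support_le hne₁ fun z hz => by
      have h := hc₁ hz
      rw [mem_closedBall, dist_eq_norm] at h
      have := (proj_le θ (z - c₁)).trans h
      rw [map_sub] at this; linarith
    have e2 : support A₂ (θ + π) ≤ -proj θ c₂ + ρ := support_le hne₂ fun z hz => by
      have h := hc₂ hz
      rw [mem_closedBall, dist_eq_norm, ← norm_neg] at h
      have := (proj_le θ _).trans h
      rw [map_neg, map_sub] at this
      rw [proj_add_pi]; linarith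
    have e3 := support_mono hne₁ hA h₁ (θ + π)
    have e4 := support_mono hne₂ hA h₂ θ
    unfold width
    rw [map_sub]; linarith
  -- The absolute value comes from choosing which piece is in front, separately for each direction.
  have key : ∀ θ, width A₁ θ + width A₂ θ + |proj θ (c₂ - c₁)| - 2 * ρ ≤ width A θ := by
    intro θ
    rcases abs_cases (proj θ (c₂ - c₁)) with ⟨h, -⟩ | ⟨h, -⟩ <;> rw [h]
    · exact aux h₁ h₂ hne₁ hne₂ hc₁ hc₂ θ
    · have := aux h₂ h₁ hne₂ hne₁ hc₂ hc₁ θ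
      rw [← map_neg, neg_sub]; linarith
  have i1 := (continuous_width hb₁ hne₁).intervalIntegrable (μ := volume) 0 (2 * π)
  have i2 := (continuous_width hb₂ hne₂).intervalIntegrable (μ := volume) 0 (2 * π)
  have i3 := (continuous_proj_left (c₂ - c₁)).abs.intervalIntegrable (μ := volume) 0 (2 * π)
  have hne := hne₁.mono h₁
  have := intervalIntegral.integral_mono (by positivity)
    (((i1.add i2).add i3).sub (intervalIntegrable_const (c := 2 * ρ)))
    ((continuous_width hA hne).intervalIntegrable 0 (2 * π)) key
  rw [intervalIntegral.integral_sub ((i1.add i2).add i3) intervalIntegrable_const,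
    intervalIntegral.integral_add (i1.add i2) i3, intervalIntegral.integral_add i1 i2,
    integral_abs_proj, ← two_mul_hullPerimeter hA hne, ← two_mul_hullPerimeter hb₁ hne₁,
    ← two_mul_hullPerimeter hb₂ hne₂] at this
  simp at this
  linarith

end HullPerimeter

/-! ### Perimeter of the hull against length of a closed curve -/

/-- A closed walk on the line must travel between two of its positions and back again. -/
lemma two_mul_sub_le_sum_abs (x : ℕ → ℝ) {n i j : ℕ} (hx : x n = x 0) (hi : i ≤ n) (hj : j ≤ n) :
    2 * (x j - x i) ≤ ∑ l ∈ Finset.range n, |x (l + 1) - x l| := by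
  have tel : ∀ a b, a ≤ b → |x b - x a| ≤ ∑ l ∈ Finset.Ico a b, |x (l + 1) - x l| :=
    fun a b hab => by
      rw [← Finset.sum_Ico_sub x hab]
      exact Finset.abs_sum_le_sum_abs _ _
  have key : ∀ a b, a ≤ b → b ≤ n →
      2 * |x b - x a| ≤ ∑ l ∈ Finset.range n, |x (l + 1) - x l| := fun a b hab hb => by
    have h1 := tel 0 a (Nat.zero_le a)
    have h2 := tel a b hab
    have h3 := tel b n hb
    rw [Finset.range_eq_Ico, ← Finset.sum_Ico_consecutive _ (Nat.zero_le a) (hab.trans hb),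
      ← Finset.sum_Ico_consecutive _ hab hb]
    have h4 : |x b - x a| ≤ |x a - x 0| + |x n - x b| := by
      rw [hx, abs_sub_comm (x a), abs_sub_comm (x b)]
      calc |x a - x b| = |(x 0 - x b) - (x 0 - x a)| := by congr 1; ring
        _ ≤ _ := by rw [add_comm]; exact abs_sub _ _
    linarith
  rcases le_total i j with h | h
  · have := key i j h hj
    linarith [le_abs_self (x j - x i)]
  · have := key j i h hi
    rw [abs_sub_comm] at this
    linarith [le_abs_self (x j - x i)]

lemma periodic_mem_range {γ : ℝ → ℂ} (hp : Function.Periodic γ 1) {z : ℂ} (hz : z ∈ range γ) :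
    ∃ t ∈ Icc (0 : ℝ) 1, γ t = z := by
  obtain ⟨t, rfl⟩ := hz
  obtain ⟨s, hs, h⟩ := hp.exists_mem_Ico₀ one_pos t
  exact ⟨s, Ico_subset_Icc_self hs, h.symm⟩

lemma range_eq_image_Icc {γ : ℝ → ℂ} (hp : Function.Periodic γ 1) :
    range γ = γ '' Icc 0 1 := by
  apply Subset.antisymm
  · intro z hz
    obtain ⟨t, ht, rfl⟩ := periodic_mem_range hp hz
    exact mem_image_of_mem _ ht
  · exact image_subset_range _ _

lemma isCompact_range_of_periodic {γ : ℝ → ℂ} (hc : Continuous γ) (hp : Function.Periodic γ 1) :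
    IsCompact (range γ) := by
  rw [range_eq_image_Icc hp]
  exact isCompact_Icc.image hc

/-- The perimeter of the convex hull of a closed curve is at most the length of the curve. -/
lemma hullPerimeter_range_le_curveLength {γ : ℝ → ℂ} (hc : Continuous γ)
    (hp : Function.Periodic γ 1) :
    ENNReal.ofReal (hullPerimeter (range γ)) ≤ curveLength γ := by
  have hne : (range γ).Nonempty := range_nonempty γ
  have hb : IsBounded (range γ) := (isCompact_range_of_periodic hc hp).isBounded
  rcases eq_or_ne (curveLength γ) ⊤ with htop | htop
  · rw [htop]; exact le_top
  apply ENNReal.ofReal_le_of_le_toReal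
  apply le_of_forall_pos_le_add
  intro ε hε
  -- The tolerance `ε / (2 * π)` becomes a total error `ε` in the perimeter after integration over
  -- all directions.
  obtain ⟨δ, hδ, hunif⟩ := Metric.uniformContinuousOn_iff.1
    (isCompact_Icc.uniformContinuousOn_of_continuous (hc.continuousOn (s := Icc (0 : ℝ) 1)))
    (ε / (2 * π)) (by positivity)
  obtain ⟨n, hn⟩ := exists_nat_gt (1 / δ)
  have hn0 : (0 : ℝ) < n := lt_trans (by positivity) hn
  have hnδ : 1 / (n : ℝ) < δ := by
    rw [div_lt_iff₀ hn0]; rw [div_lt_iff₀ hδ] at hn; linarith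
  let p : ℕ → ℂ := fun i => γ (i / n)
  have hp0 : p n = p 0 := by
    simp only [p]
    rw [div_self hn0.ne', Nat.cast_zero, zero_div]
    simpa using hp 0
  have hlen : ∑ i ∈ Finset.range n, ‖p (i + 1) - p i‖ ≤ (curveLength γ).toReal := by
    rw [← ENNReal.ofReal_le_iff_le_toReal htop, ENNReal.ofReal_sum_of_nonneg (fun _ _ => norm_nonneg _)]
    have hmono : MonotoneOn (fun i : ℕ => (i / n : ℝ)) (Icc 0 n) := fun i _ j _ hij => by
      have : (i : ℝ) ≤ j := by exact_mod_cast hij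
      dsimp only
      gcongr
    have := eVariationOn.sum_le_of_monotoneOn_Icc (f := γ) (s := Icc 0 1) hmono fun i hi => by
      refine ⟨by positivity, ?_⟩
      rw [div_le_one hn0]
      exact_mod_cast hi.2
    rw [← Finset.range_eq_Ico] at this
    refine le_trans (le_of_eq ?_) this
    refine Finset.sum_congr rfl fun i _ => ?_
    rw [edist_dist, dist_eq_norm]
  have hnear : ∀ z ∈ range γ, ∃ i ≤ n, ‖z - p i‖ ≤ ε / (2 * π) := by
    intro z hz
    obtain ⟨t, ht, rfl⟩ := periodic_mem_range hp hz
    have htn : 0 ≤ t * n := mul_nonneg ht.1 hn0.le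
    have hfl := Nat.floor_le htn
    have hfl' := Nat.lt_floor_add_one (t * n)
    have hle : ⌊t * n⌋₊ ≤ n := by
      rw [← Nat.floor_natCast (R := ℝ) n]
      exact Nat.floor_le_floor (by simpa using mul_le_of_le_one_left hn0.le ht.2)
    refine ⟨⌊t * n⌋₊, hle, ?_⟩
    have hlt : dist (γ t) (γ (⌊t * n⌋₊ / n)) < ε / (2 * π) := by
      apply hunif t ht
      · refine ⟨by positivity, ?_⟩
        rw [div_le_one hn0]
        exact_mod_cast hle
      · rw [Real.dist_eq, abs_of_nonneg]
        · refine lt_trans ?_ hnδ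
          rw [sub_lt_iff_lt_add, ← add_div, lt_div_iff₀ hn0]
          linarith
        · rw [sub_nonneg, div_le_iff₀ hn0]
          exact hfl
    rw [dist_eq_norm] at hlt
    exact hlt.le
  -- In each direction the width is at most half the variation of the projected inscribed polygon,
  -- up to the distance of the curve from its vertices.
  have hw : ∀ θ, width (range γ) θ ≤
      (∑ i ∈ Finset.range n, |proj θ (p (i + 1) - p i)|) / 2 + 2 * (ε / (2 * π)) := fun θ => by
    apply width_le hne
    intro z hz w hw
    obtain ⟨i, hi, hzi⟩ := hnear z hz
    obtain ⟨j, hj, hwj⟩ := hnear w hw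
    have h1 := two_mul_sub_le_sum_abs (fun i => proj θ (p i)) (by simp only [hp0]) hj hi
    have h2 := (proj_le θ (z - p i)).trans hzi
    have h3 := (neg_abs_le _).trans' (neg_le_neg ((abs_proj_le θ (w - p j)).trans hwj))
    simp only [map_sub] at h2 h3 ⊢
    linarith
  have hcont : ∀ i, Continuous fun θ => |proj θ (p (i + 1) - p i)| :=
    fun i => (continuous_proj_left _).abs
  have hsc : Continuous fun θ => ∑ i ∈ Finset.range n, |proj θ (p (i + 1) - p i)| :=
    continuous_finsetSum _ fun i _ => hcont i
  have hg : Continuous fun θ => (∑ i ∈ Finset.range n, |proj θ (p (i + 1) - p i)|) / 2 +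
      2 * (ε / (2 * π)) := (hsc.div_const 2).add continuous_const
  have := hullPerimeter_le_of_width_le hb hne hg hw
  rw [intervalIntegral.integral_add ((hsc.div_const 2).intervalIntegrable _ _) (by simp),
    intervalIntegral.integral_div, intervalIntegral.integral_finsetSum
      (fun i _ => (hcont i).intervalIntegrable _ _)] at this
  simp only [integral_abs_proj, ← Finset.mul_sum, intervalIntegral.integral_const, sub_zero,
    smul_eq_mul] at this
  have e : 2 * π * (2 * (ε / (2 * π))) = 2 * ε := by field_simp
  rw [e] at this
  linarith

/-! ### Planar topology: filling in a boundary by disjoint convex sets -/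

/-- A preconnected set covered by a finite disjoint family of closed sets lies in one of them. -/
lemma exists_subset_of_isPreconnected {α ι : Type*} [TopologicalSpace α] {t : Set α}
    (ht : IsPreconnected t) (hne : t.Nonempty) (s : Finset ι) (C : ι → Set α)
    (hC : ∀ i ∈ s, IsClosed (C i)) (hd : (s : Set ι).PairwiseDisjoint C)
    (hcov : t ⊆ ⋃ i ∈ s, C i) : ∃ i ∈ s, t ⊆ C i := by
  classical
  obtain ⟨x, hx⟩ := hne
  obtain ⟨i, hi, hxi⟩ := mem_iUnion₂.1 (hcov hx)
  refine ⟨i, hi, ?_⟩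
  have hcl : IsClosed (⋃ j ∈ s.erase i, C j) :=
    isClosed_biUnion_finset fun j hj => hC j (Finset.mem_of_mem_erase hj)
  have hdis : Disjoint (C i) (⋃ j ∈ s.erase i, C j) := by
    rw [disjoint_iUnion₂_right]
    intro j hj
    exact hd hi (Finset.mem_of_mem_erase hj) (Finset.ne_of_mem_erase hj).symm
  have := isPreconnected_iff_subset_of_disjoint_closed.1 ht (C i) _ (hC i hi) hcl (by
    intro y hy
    obtain ⟨j, hj, hyj⟩ := mem_iUnion₂.1 (hcov hy)
    rcases eq_or_ne j i with rfl | hji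
    · exact Or.inl hyj
    · exact Or.inr (mem_iUnion₂.2 ⟨j, Finset.mem_erase.2 ⟨hji, hj⟩, hyj⟩))
    (by rw [hdis.inter_eq, inter_empty])
  rcases this with h | h
  · exact h
  · exact absurd (h hx) (disjoint_left.1 hdis hxi)

lemma isPreconnected_annulus (a b : ℝ) (ha : 0 ≤ a) :
    IsPreconnected (ball (0 : ℂ) b \ closedBall 0 a) := by
  have : ball (0 : ℂ) b \ closedBall 0 a =
      (fun p : ℝ × ℝ => (p.1 : ℂ) * Complex.exp (p.2 * Complex.I)) '' (Ioo a b ×ˢ univ) := by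
    ext z
    simp only [mem_sdiff, mem_ball_zero_iff, mem_closedBall_zero_iff, not_le, mem_image, mem_prod,
      mem_Ioo, mem_univ, and_true, Prod.exists]
    constructor
    · rintro ⟨h1, h2⟩
      exact ⟨‖z‖, z.arg, ⟨h2, h1⟩, Complex.norm_mul_exp_arg_mul_I z⟩
    · rintro ⟨x, y, ⟨h1, h2⟩, rfl⟩
      rw [norm_mul, Complex.norm_exp_ofReal_mul_I, mul_one, Complex.norm_real,
        Real.norm_of_nonneg (ha.trans h1.le)]
      exact ⟨h2, h1⟩
  rw [this]
  exact (isPreconnected_Ioo.prod isPreconnected_univ).image _ (by fun_prop)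

/-- A planar convex body has arbitrarily small annular neighbourhoods. -/
lemma exists_annular_nhds {D O : Set ℂ} (hD : IsCompact D) (hconv : Convex ℝ D)
    (hne : D.Nonempty) (hO : IsOpen O) (hDO : D ⊆ O) :
    ∃ s N : Set ℂ, IsCompact s ∧ IsOpen N ∧ IsBounded N ∧ D ⊆ interior s ∧ s ⊆ N ∧ N ⊆ O ∧
      IsPreconnected (N \ s) := by
  -- Thickening first gives the convex body an interior, which `D` may lack (it can be a segment or
  -- a point). A homeomorphism of the plane then straightens it to the unit disc.
  obtain ⟨δ, hδ, hsub⟩ := hD.exists_cthickening_subset_open hO hDO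
  have hsc : IsCompact (cthickening δ D) := hD.cthickening
  have hint : D ⊆ interior (cthickening δ D) :=
    (self_subset_thickening hδ D).trans (interior_maximal (thickening_subset_cthickening δ D)
      isOpen_thickening)
  obtain ⟨e, -, he, -⟩ := exists_homeomorph_image_interior_closure_frontier_eq_unitBall
    (hconv.cthickening δ) (hne.mono hint) hsc.isBounded
  rw [hsc.isClosed.closure_eq] at he
  have hO' : IsOpen (e '' O) := e.isOpenMap _ hO
  obtain ⟨η, hη, hsub'⟩ := (isCompact_closedBall (0 : ℂ) 1).exists_thickening_subset_open hO'
    (he ▸ image_mono hsub)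
  rw [thickening_closedBall hη zero_le_one] at hsub'
  have hs : cthickening δ D = e ⁻¹' closedBall 0 1 := by
    rw [← he, preimage_image_eq _ e.injective]
  refine ⟨cthickening δ D, e ⁻¹' ball 0 (η + 1), hsc, isOpen_ball.preimage e.continuous, ?_, hint,
    ?_, ?_, ?_⟩
  · refine IsBounded.subset (t := e ⁻¹' closedBall 0 (η + 1)) ?_
      (preimage_mono ball_subset_closedBall)
    exact (e.isCompact_preimage.2 (isCompact_closedBall _ _)).isBounded
  · rw [hs]
    exact preimage_mono (closedBall_subset_ball (by linarith))
  · rw [← preimage_image_eq O e.injective]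
    exact preimage_mono hsub'
  · rw [hs, ← preimage_sdiff, ← e.image_symm]
    exact (isPreconnected_annulus 1 (η + 1) zero_le_one).image _ e.symm.continuous.continuousOn

/-- Finitely many pairwise disjoint compact sets have pairwise disjoint open neighbourhoods,
which moreover avoid a given point outside of these sets. -/
lemma exists_disjoint_open_nhds {ι : Type*} (s : Finset ι) (D : ι → Set ℂ)
    (hD : ∀ i ∈ s, IsCompact (D i)) (hd : (s : Set ι).PairwiseDisjoint D) {x : ℂ}
    (hx : ∀ i ∈ s, x ∉ D i) :
    ∃ O : ι → Set ℂ, (∀ i ∈ s, IsOpen (O i) ∧ D i ⊆ O i ∧ x ∉ O i) ∧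
      (s : Set ι).PairwiseDisjoint O := by
  classical
  induction s using Finset.induction_on with
  | empty => exact ⟨fun _ => ∅, by simp, by simp⟩
  | insert a s ha ih =>
    obtain ⟨O, hO, hOd⟩ := ih (fun i hi => hD i (Finset.mem_insert_of_mem hi))
      (hd.subset (by simp)) (fun i hi => hx i (Finset.mem_insert_of_mem hi))
    have hDa := hD a (Finset.mem_insert_self a s)
    have hcs : IsCompact (⋃ i ∈ s, D i) :=
      s.isCompact_biUnion fun i hi => hD i (Finset.mem_insert_of_mem hi)
    have hdis : Disjoint (D a) ((⋃ i ∈ s, D i) ∪ {x}) := by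
      rw [disjoint_union_right, disjoint_iUnion₂_right, disjoint_singleton_right]
      refine ⟨fun i hi => hd (by simp) (by simp [hi]) ?_, hx a (Finset.mem_insert_self a s)⟩
      rintro rfl; exact ha hi
    obtain ⟨P, Q, hP, hQ, hDP, hDQ, hPQ⟩ :=
      SeparatedNhds.of_isCompact_isCompact hDa (hcs.union isCompact_singleton) hdis
    refine ⟨fun i => if i = a then P else O i ∩ Q, ?_, ?_⟩
    · intro i hi
      rcases Finset.mem_insert.1 hi with rfl | hi'
      · simp only [if_true]
        exact ⟨hP, hDP, fun h => disjoint_left.1 hPQ h (hDQ (Or.inr rfl))⟩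
      · have hia : i ≠ a := by rintro rfl; exact ha hi'
        simp only [hia, if_false]
        obtain ⟨h1, h2, h3⟩ := hO i hi'
        exact ⟨h1.inter hQ, subset_inter h2 (fun y hy => hDQ (Or.inl (mem_iUnion₂.2 ⟨i, hi', hy⟩))),
          fun h => h3 h.1⟩
    · intro i hi j hj hij
      have hi' := Finset.mem_insert.1 (Finset.mem_coe.1 hi)
      have hj' := Finset.mem_insert.1 (Finset.mem_coe.1 hj)
      simp only [Function.onFun]
      by_cases h1 : i = a
      · have h2 : j ≠ a := fun h => hij (h1.trans h.symm)
        simp only [h1, h2, if_true, if_false]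
        exact hPQ.mono_right inter_subset_right
      · by_cases h2 : j = a
        · simp only [h1, h2, if_true, if_false]
          exact hPQ.symm.mono_left inter_subset_right
        · simp only [h1, h2, if_false]
          exact (hOd (hi'.resolve_left h1) (hj'.resolve_left h2) hij).mono
            inter_subset_left inter_subset_left

/-- Pairwise disjoint compact convex sets that contain the boundary of a bounded open planar set
contain the set itself. -/
lemma subset_biUnion_of_frontier_subset {ι : Type*} (s : Finset ι) (D : ι → Set ℂ)
    (hD : ∀ i ∈ s, IsCompact (D i)) (hconv : ∀ i ∈ s, Convex ℝ (D i))
    (hne : ∀ i ∈ s, (D i).Nonempty) (hd : (s : Set ι).PairwiseDisjoint D) {V : Set ℂ}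
    (hV : IsOpen V) (hVb : IsBounded V) (hf : frontier V ⊆ ⋃ i ∈ s, D i) :
    V ⊆ ⋃ i ∈ s, D i := by
  classical
  intro x hxV
  by_contra hx
  simp only [mem_iUnion, not_exists] at hx
  obtain ⟨O, hO, hOd⟩ := exists_disjoint_open_nhds s D hD hd hx
  have hex : ∀ i : ι, ∃ S N : Set ℂ, i ∈ s → IsCompact S ∧ IsOpen N ∧ IsBounded N ∧
      D i ⊆ interior S ∧ S ⊆ N ∧ N ⊆ O i ∧ IsPreconnected (N \ S) := fun i => by
    by_cases hi : i ∈ s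
    · obtain ⟨S, N, h⟩ := exists_annular_nhds (hD i hi) (hconv i hi) (hne i hi) (hO i hi).1
        (hO i hi).2.1
      exact ⟨S, N, fun _ => h⟩
    · exact ⟨∅, ∅, fun h => absurd h hi⟩
  choose S N hSN using hex
  have hNd : ∀ i ∈ s, ∀ j ∈ s, ∀ z, z ∈ N i → z ∈ N j → i = j := fun i hi j hj z h1 h2 => by
    by_contra hij
    exact disjoint_left.1 (hOd hi hj hij) ((hSN i hi).2.2.2.2.2.1 h1) ((hSN j hj).2.2.2.2.2.1 h2)
  have hSc : IsClosed (⋃ i ∈ s, S i) :=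
    isClosed_biUnion_finset fun i hi => (hSN i hi).1.isClosed
  let W := (closure V)ᶜ
  have hW : IsOpen W := isClosed_closure.isOpen_compl
  have hVW : ∀ z, z ∉ (⋃ i ∈ s, S i) → z ∈ V ∨ z ∈ W := fun z hz => by
    by_contra! h
    have hzf : z ∈ frontier V := by
      rw [hV.frontier_eq]; exact ⟨not_not.1 h.2, h.1⟩
    obtain ⟨i, hi, hzi⟩ := mem_iUnion₂.1 (hf hzf)
    exact hz (mem_iUnion₂.2 ⟨i, hi, interior_subset ((hSN i hi).2.2.2.1 hzi)⟩)
  have hVWd : ∀ z, z ∈ V → z ∈ W → False := fun z h1 h2 => h2 (subset_closure h1)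
  have hann : ∀ i ∈ s, ∀ z ∈ N i \ S i, z ∉ ⋃ i ∈ s, S i := fun i hi z hz h => by
    obtain ⟨j, hj, hzj⟩ := mem_iUnion₂.1 h
    have := hNd i hi j hj z hz.1 ((hSN j hj).2.2.2.2.1 hzj)
    subst this
    exact hz.2 hzj
  -- Each annulus is connected and misses the boundary of `V`, so it lies entirely inside or
  -- entirely outside.
  have hside : ∀ i ∈ s, N i \ S i ⊆ V ∨ N i \ S i ⊆ W := fun i hi => by
    refine isPreconnected_iff_subset_of_disjoint.1 (hSN i hi).2.2.2.2.2.2 V W hV hW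
      (fun z hz => hVW z (hann i hi z hz)) ?_
    ext z
    simp only [mem_inter_iff, mem_empty_iff_false, iff_false, not_and]
    exact fun _ h1 h2 => hVWd z h1 h2
  let t := s.filter fun i => N i \ S i ⊆ V
  -- Every hole is refilled with the side its annulus lies on. This splits the plane into two
  -- disjoint open sets; `P` is bounded and `Q` misses `x`, so neither can be the whole plane.
  let P := (V \ ⋃ i ∈ s, S i) ∪ ⋃ i ∈ t, N i
  let Q := (W \ ⋃ i ∈ s, S i) ∪ ⋃ i ∈ s \ t, N i
  have hP : IsOpen P := (hV.sdiff hSc).union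
    (isOpen_biUnion fun i hi => (hSN i (Finset.mem_filter.1 hi).1).2.1)
  have hQ : IsOpen Q := (hW.sdiff hSc).union
    (isOpen_biUnion fun i hi => (hSN i (Finset.mem_sdiff.1 hi).1).2.1)
  have hcov : univ ⊆ P ∪ Q := fun z _ => by
    by_cases hz : z ∈ ⋃ i ∈ s, S i
    · obtain ⟨i, hi, hzi⟩ := mem_iUnion₂.1 hz
      have hzN := (hSN i hi).2.2.2.2.1 hzi
      by_cases hit : i ∈ t
      · exact Or.inl (Or.inr (mem_iUnion₂.2 ⟨i, hit, hzN⟩))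
      · exact Or.inr (Or.inr (mem_iUnion₂.2 ⟨i, Finset.mem_sdiff.2 ⟨hi, hit⟩, hzN⟩))
    · rcases hVW z hz with h | h
      · exact Or.inl (Or.inl ⟨h, hz⟩)
      · exact Or.inr (Or.inl ⟨h, hz⟩)
  have hdis : univ ∩ (P ∩ Q) = ∅ := by
    ext z
    simp only [mem_empty_iff_false, iff_false]
    rintro ⟨-, hzP, hzQ⟩
    rcases hzP with ⟨hzV, hzS⟩ | hzP <;> rcases hzQ with ⟨hzW, hzS'⟩ | hzQ
    · exact hVWd z hzV hzW
    · obtain ⟨i, hi, hzi⟩ := mem_iUnion₂.1 hzQ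
      obtain ⟨his, hit⟩ := Finset.mem_sdiff.1 hi
      have hsub : N i \ S i ⊆ W := (hside i his).resolve_left fun h =>
        hit (Finset.mem_filter.2 ⟨his, h⟩)
      exact hVWd z hzV (hsub ⟨hzi, fun h => hzS (mem_iUnion₂.2 ⟨i, his, h⟩)⟩)
    · obtain ⟨i, hi, hzi⟩ := mem_iUnion₂.1 hzP
      obtain ⟨his, hit⟩ := Finset.mem_filter.1 hi
      exact hVWd z (hit ⟨hzi, fun h => hzS' (mem_iUnion₂.2 ⟨i, his, h⟩)⟩) hzW
    · obtain ⟨i, hi, hzi⟩ := mem_iUnion₂.1 hzP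
      obtain ⟨j, hj, hzj⟩ := mem_iUnion₂.1 hzQ
      obtain ⟨hjs, hjt⟩ := Finset.mem_sdiff.1 hj
      have := hNd i (Finset.mem_filter.1 hi).1 j hjs z hzi hzj
      subst this
      exact hjt hi
  rcases isPreconnected_iff_subset_of_disjoint.1 isPreconnected_univ P Q hP hQ hcov hdis with h | h
  · have hPb : IsBounded P := (hVb.subset sdiff_subset).union
      ((isBounded_biUnion_finset t).2 fun i hi => (hSN i (Finset.mem_filter.1 hi).1).2.2.1)
    exact NormedSpace.unbounded_univ ℝ ℂ (hPb.subset h)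
  · have hxQ := h (mem_univ x)
    have hxN : ∀ i ∈ s, x ∉ N i := fun i hi hxi => (hO i hi).2.2 ((hSN i hi).2.2.2.2.2.1 hxi)
    rcases hxQ with hxQ | hxQ
    · exact hVWd x hxV hxQ.1
    · obtain ⟨i, hi, hxi⟩ := mem_iUnion₂.1 hxQ
      exact hxN i (Finset.mem_sdiff.1 hi).1 hxi

/-! ### Merging hulls into disjoint convex sets -/

/-- Finitely many bounded sets, each in a member of a disjoint family of closed convex sets, can be
covered by disjoint compact convex sets of no larger total perimeter. -/
lemma exists_disjoint_convex_cover {κ : Type*} {n : ℕ} (G : Fin n → Set ℂ)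
    (hb : ∀ i, IsBounded (G i)) (hne : ∀ i, (G i).Nonempty) (I : Set κ) (W : κ → Set ℂ)
    (hW : ∀ a ∈ I, IsClosed (W a) ∧ Convex ℝ (W a)) (hWd : I.PairwiseDisjoint W)
    (hGW : ∀ i, ∃ a ∈ I, G i ⊆ W a) :
    ∃ s : Finset (Set ℂ), (∀ D ∈ s, IsCompact D ∧ Convex ℝ D ∧ D.Nonempty ∧ ∃ a ∈ I, D ⊆ W a) ∧
      (s : Set (Set ℂ)).PairwiseDisjoint id ∧ (∀ i, G i ⊆ ⋃ D ∈ s, D) ∧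
      ∑ D ∈ s, hullPerimeter D ≤ ∑ i, hullPerimeter (G i) := by
  classical
  let Good : Finset (Set ℂ) → Prop := fun s =>
    (∀ D ∈ s, IsCompact D ∧ Convex ℝ D ∧ D.Nonempty ∧ ∃ a ∈ I, D ⊆ W a) ∧
      (∀ i, G i ⊆ ⋃ D ∈ s, D) ∧ ∑ D ∈ s, hullPerimeter D ≤ ∑ i, hullPerimeter (G i)
  let H : Set ℂ → Set ℂ := fun A => closure (convexHull ℝ A)
  have hH : ∀ A, IsBounded A → A.Nonempty → (∃ a ∈ I, A ⊆ W a) →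
      IsCompact (H A) ∧ Convex ℝ (H A) ∧ (H A).Nonempty ∧ ∃ a ∈ I, H A ⊆ W a := by
    rintro A hA hAne ⟨a, ha, hAa⟩
    exact ⟨(isBounded_convexHull.2 hA).isCompact_closure, (convex_convexHull ℝ A).closure,
      hAne.convexHull.closure, a, ha, closure_minimal (convexHull_min hAa (hW a ha).2) (hW a ha).1⟩
  have hsub : ∀ A, A ⊆ H A := fun A => (subset_convexHull ℝ A).trans subset_closure
  have hex : ∃ m, ∃ s, Good s ∧ s.card = m := by
    refine ⟨_, Finset.univ.image fun i => H (G i), ⟨?_, ?_, ?_⟩, rfl⟩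
    · intro D hD
      obtain ⟨i, -, rfl⟩ := Finset.mem_image.1 hD
      exact hH _ (hb i) (hne i) (hGW i)
    · intro i z hz
      exact mem_iUnion₂.2 ⟨H (G i), Finset.mem_image_of_mem _ (Finset.mem_univ i), hsub _ hz⟩
    · refine (Finset.sum_image_le_of_nonneg ?_).trans (Finset.sum_le_sum fun i _ =>
        hullPerimeter_closure_convexHull_le (hb i) (hne i))
      intro D hD
      obtain ⟨i, -, rfl⟩ := Finset.mem_image.1 hD
      exact hullPerimeter_nonneg (hH _ (hb i) (hne i) (hGW i)).1.isBounded
  -- A cover with the fewest members is disjoint: two members that meet could be replaced by the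
  -- hull of their union.
  obtain ⟨s, hs, hcard⟩ := Nat.find_spec hex
  refine ⟨s, hs.1, ?_, hs.2.1, hs.2.2⟩
  intro C hC D hD hCD
  by_contra hdis
  obtain ⟨x, hxC, hxD⟩ := not_disjoint_iff.1 hdis
  obtain ⟨hC1, hC2, hC3, a, ha, hCa⟩ := hs.1 C hC
  obtain ⟨hD1, hD2, hD3, b, hb', hDb⟩ := hs.1 D hD
  -- Sets that meet lie in the same `W a`, so the merged hull stays there too. This keeps diameters
  -- small in the application.
  have hab : a = b := by
    by_contra hab
    exact disjoint_left.1 (hWd ha hb' hab) (hCa hxC) (hDb hxD)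
  subst hab
  have hbCD : IsBounded (C ∪ D) := hC1.isBounded.union hD1.isBounded
  have hneCD : (C ∪ D).Nonempty := hC3.mono subset_union_left
  let s' := (s.erase C).erase D
  have hDC : D ∈ s.erase C := Finset.mem_erase.2 ⟨hCD.symm, hD⟩
  have hHCD := hH (C ∪ D) hbCD hneCD ⟨a, ha, union_subset hCa hDb⟩
  have hgood : Good (insert (H (C ∪ D)) s') := by
    refine ⟨?_, ?_, ?_⟩
    · intro E hE
      rcases Finset.mem_insert.1 hE with rfl | hE
      · exact hHCD
      · exact hs.1 E (Finset.mem_of_mem_erase (Finset.mem_of_mem_erase hE))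
    · intro i z hz
      obtain ⟨E, hE, hzE⟩ := mem_iUnion₂.1 (hs.2.1 i hz)
      by_cases hEC : E = C
      · exact mem_iUnion₂.2 ⟨_, Finset.mem_insert_self _ _, hsub _ (Or.inl (hEC ▸ hzE))⟩
      by_cases hED : E = D
      · exact mem_iUnion₂.2 ⟨_, Finset.mem_insert_self _ _, hsub _ (Or.inr (hED ▸ hzE))⟩
      exact mem_iUnion₂.2 ⟨E, Finset.mem_insert_of_mem
        (Finset.mem_erase.2 ⟨hED, Finset.mem_erase.2 ⟨hEC, hE⟩⟩), hzE⟩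
    · have h1 : ∑ E ∈ insert (H (C ∪ D)) s', hullPerimeter E ≤
          hullPerimeter (H (C ∪ D)) + ∑ E ∈ s', hullPerimeter E := by
        by_cases hmem : H (C ∪ D) ∈ s'
        · rw [Finset.insert_eq_of_mem hmem]
          linarith [hullPerimeter_nonneg hHCD.1.isBounded]
        · rw [Finset.sum_insert hmem]
      have h2 := hullPerimeter_closure_convexHull_le hbCD hneCD
      have h3 := hullPerimeter_union_le hC1.isBounded hD1.isBounded ⟨x, hxC, hxD⟩
      have h4 := Finset.add_sum_erase s hullPerimeter hC
      have h5 := Finset.add_sum_erase (s.erase C) hullPerimeter hDC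
      have h6 := hs.2.2
      simp only [H, s'] at h1 ⊢
      linarith
  have hlt : (insert (H (C ∪ D)) s').card < s.card := by
    have h1 := Finset.card_insert_le (H (C ∪ D)) s'
    have h2 := Finset.card_erase_lt_of_mem hDC
    have h3 := Finset.card_erase_lt_of_mem (Finset.mem_coe.1 hC)
    simp only [s'] at h1 ⊢
    omega
  rw [hcard] at hlt
  exact Nat.find_min hex hlt ⟨_, hgood, rfl⟩

/-! ### The tree of construction balls: radii, centres and separation -/

/-- The radius of the construction balls of level `k`. -/
noncomputable def radius : ℕ → ℝ
  | 0 => 1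
  | 1 => 1
  | k + 2 => radius (k + 1) / 2 ^ (k + 2)

lemma radius_succ {k : ℕ} (hk : 1 ≤ k) : radius (k + 1) = radius k / 2 ^ (k + 1) := by
  obtain ⟨k, rfl⟩ := Nat.exists_eq_add_of_le' hk
  rfl

lemma radius_pos : ∀ k, 0 < radius k
  | 0 => one_pos
  | 1 => one_pos
  | k + 2 => div_pos (radius_pos (k + 1)) (by positivity)

lemma radius_eq_pow_mul {k : ℕ} (hk : 1 ≤ k) : radius k = 2 ^ (k + 1) * radius (k + 1) := by
  rw [radius_succ hk]; field_simp

lemma radius_le_half_pow (k : ℕ) : radius (k + 1) ≤ (1 / 2) ^ k := by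
  induction k with
  | zero => simp [radius]
  | succ k ih =>
    rw [radius_succ (by omega), pow_succ (1 / 2 : ℝ)]
    have h : (2 : ℝ) ≤ 2 ^ (k + 1 + 1) := by
      calc (2 : ℝ) = 2 ^ 1 := (pow_one 2).symm
        _ ≤ _ := pow_le_pow_right₀ one_le_two (by omega)
    calc radius (k + 1) / 2 ^ (k + 1 + 1) ≤ radius (k + 1) / 2 := by
          have := (radius_pos (k + 1)).le
          gcongr
      _ ≤ _ := by linarith

lemma tendsto_radius : Filter.Tendsto (fun k => radius (k + 1)) Filter.atTop (nhds 0) :=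
  squeeze_zero (fun k => (radius_pos _).le) radius_le_half_pow
    (tendsto_pow_atTop_nhds_zero_of_lt_one (by norm_num) (by norm_num))

lemma radius_antitone {k l : ℕ} (hk : 1 ≤ k) (h : k ≤ l) : radius l ≤ radius k := by
  induction l, h using Nat.le_induction with
  | base => exact le_rfl
  | succ l hl ih =>
    rw [radius_succ (hk.trans hl)]
    exact (div_le_self (radius_pos l).le (one_le_pow₀ one_le_two)).trans ih

/-- The centre of the `j`-th ball of level `k + 1` in the ball of level `k` with centre `c`. -/
noncomputable def child (c : ℂ) (k j : ℕ) : ℂ :=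
  c + ((radius k * (1 - 1 / 2 ^ (k + 1)) : ℝ) : ℂ) *
    Complex.exp (((2 * π * j / 2 ^ (k + 1) : ℝ) : ℂ) * Complex.I)

/-- The centres of the balls of level `k + d` in the ball of level `k` with centre `c`. -/
noncomputable def desc : ℂ → ℕ → ℕ → Finset ℂ
  | c, _, 0 => {c}
  | c, k, d + 1 => (Finset.Icc 1 (2 ^ (k + 1))).biUnion fun j => desc (child c k j) (k + 1) d

lemma mem_desc_succ {c x : ℂ} {k d : ℕ} :
    x ∈ desc c k (d + 1) ↔ ∃ j ∈ Finset.Icc 1 (2 ^ (k + 1)), x ∈ desc (child c k j) (k + 1) d := by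
  rw [desc, Finset.mem_biUnion]

/-- `desc` branches at the root; this is the recursion at the leaves, which matches `wordMap`. -/
lemma mem_desc_succ' {c x : ℂ} {k d : ℕ} :
    x ∈ desc c k (d + 1) ↔
      ∃ y ∈ desc c k d, ∃ j ∈ Finset.Icc 1 (2 ^ (k + d + 1)), x = child y (k + d) j := by
  induction d generalizing c k with
  | zero => simp [desc]
  | succ d ih =>
    rw [mem_desc_succ]
    simp only [ih]
    constructor
    · rintro ⟨i, hi, y, hy, j, hj, rfl⟩
      refine ⟨y, mem_desc_succ.2 ⟨i, hi, hy⟩, j, ?_, ?_⟩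
      · rwa [show k + (d + 1) + 1 = k + 1 + d + 1 by ring]
      · rw [show k + (d + 1) = k + 1 + d by ring]
    · rintro ⟨y, hy, j, hj, rfl⟩
      obtain ⟨i, hi, hy⟩ := mem_desc_succ.1 hy
      refine ⟨i, hi, y, hy, j, ?_, ?_⟩
      · rwa [show k + 1 + d + 1 = k + (d + 1) + 1 by ring]
      · rw [show k + (d + 1) = k + 1 + d by ring]

lemma one_sub_nonneg (k : ℕ) : (0 : ℝ) ≤ 1 - 1 / 2 ^ k :=
  sub_nonneg.2 (div_le_one_of_le₀ (one_le_pow₀ one_le_two) (by positivity))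

lemma dist_child (c : ℂ) (k j : ℕ) :
    dist (child c k j) c = radius k * (1 - 1 / 2 ^ (k + 1)) := by
  rw [dist_eq_norm, child, add_sub_cancel_left, norm_mul, Complex.norm_exp_ofReal_mul_I, mul_one,
    Complex.norm_real, Real.norm_of_nonneg]
  exact mul_nonneg (radius_pos k).le (one_sub_nonneg _)

lemma closedBall_child_subset {k : ℕ} (hk : 1 ≤ k) (c : ℂ) (j : ℕ) {l : ℝ} (hl : 1 ≤ l) :
    closedBall (child c k j) (l * radius (k + 1)) ⊆ closedBall c (l * radius k) := by
  apply closedBall_subset_closedBall'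
  rw [dist_child, radius_succ hk]
  have hr := radius_pos k
  have h : 0 ≤ (l - 1) * (radius k * (1 - 1 / 2 ^ (k + 1))) :=
    mul_nonneg (by linarith) (mul_nonneg hr.le (one_sub_nonneg _))
  have e : l * radius k - (l * (radius k / 2 ^ (k + 1)) + radius k * (1 - 1 / 2 ^ (k + 1))) =
    (l - 1) * (radius k * (1 - 1 / 2 ^ (k + 1))) := by ring
  linarith

lemma closedBall_desc_subset {k : ℕ} (hk : 1 ≤ k) {d : ℕ} {c x : ℂ} (hx : x ∈ desc c k d) {l : ℝ}
    (hl : 1 ≤ l) : closedBall x (l * radius (k + d)) ⊆ closedBall c (l * radius k) := by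
  induction d generalizing c k with
  | zero => rw [desc, Finset.mem_singleton] at hx; simp [hx]
  | succ d ih =>
    obtain ⟨j, -, hj⟩ := mem_desc_succ.1 hx
    have := ih (by omega) hj
    rw [show k + (d + 1) = k + 1 + d by ring]
    exact this.trans (closedBall_child_subset hk c j hl)

lemma norm_exp_sub_exp (α β : ℝ) :
    ‖Complex.exp (α * Complex.I) - Complex.exp (β * Complex.I)‖ = 2 * |Real.sin ((α - β) / 2)| := by
  have : Complex.exp (α * Complex.I) - Complex.exp (β * Complex.I) =
      Complex.exp (β * Complex.I) * (Complex.exp (Complex.I * ((α - β : ℝ) : ℂ)) - 1) := by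
    rw [mul_sub, ← Complex.exp_add, mul_one]
    congr 2
    push_cast; ring
  rw [this, norm_mul, Complex.norm_exp_ofReal_mul_I, one_mul, Complex.norm_exp_I_mul_ofReal_sub_one,
    norm_mul, Real.norm_eq_abs, Real.norm_eq_abs]
  norm_num

lemma norm_child_sub_child (c : ℂ) (k i j : ℕ) :
    ‖child c k i - child c k j‖ = radius k * (1 - 1 / 2 ^ (k + 1)) *
      (2 * |Real.sin (π * ((i : ℝ) - j) / 2 ^ (k + 1))|) := by
  rw [child, child, add_sub_add_left_eq_sub, ← mul_sub, norm_mul, norm_exp_sub_exp,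
    Complex.norm_real, Real.norm_of_nonneg (mul_nonneg (radius_pos k).le (one_sub_nonneg _))]
  congr 4
  ring

lemma two_div_mul_le_sin {N t : ℝ} (hN : 0 < N) (ht : 0 ≤ t) (htN : 2 * t ≤ N) :
    2 * t / N ≤ Real.sin (π * t / N) := by
  have h := Real.mul_le_sin (x := π * t / N) (by positivity) (by
    rw [div_le_div_iff₀ hN two_pos]
    nlinarith [Real.pi_pos])
  have e : 2 / π * (π * t / N) = 2 * t / N := by field_simp
  rwa [e] at h

lemma two_div_le_abs_sin {N t : ℝ} (hN : 2 ≤ N) (ht : 1 ≤ |t|) (htN : |t| ≤ N - 1) :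
    2 / N ≤ |Real.sin (π * t / N)| := by
  have hN0 : 0 < N := by linarith
  have key : ∀ t, 1 ≤ t → t ≤ N - 1 → 2 / N ≤ Real.sin (π * t / N) := by
    intro t h1 h2
    rcases le_total (2 * t) N with h | h
    · refine le_trans ?_ (two_div_mul_le_sin hN0 (by linarith) h)
      gcongr; linarith
    · have := two_div_mul_le_sin hN0 (t := N - t) (by linarith) (by linarith)
      rw [show π * (N - t) / N = π - π * t / N by field_simp, Real.sin_pi_sub] at this
      refine le_trans ?_ this
      gcongr; linarith
  rcases abs_cases t with ⟨h, -⟩ | ⟨h, -⟩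
  · exact (key t (h ▸ ht) (h ▸ htN)).trans (le_abs_self _)
  · have := key (-t) (h ▸ ht) (h ▸ htN)
    rw [mul_neg, neg_div, Real.sin_neg] at this
    exact this.trans (neg_le_abs _)

/-- With `N = 2 ^ (k + 1) ≥ 4`, a chord between distinct `N`-th roots of unity is at least `4 / N`,
and the circle of centres has radius at least `3 / 4` of the parent's. The product is `3 / N` of the
parent radius. -/
lemma three_mul_radius_le {k : ℕ} (hk : 1 ≤ k) (c : ℂ) {i j : ℕ}
    (hi : i ∈ Finset.Icc 1 (2 ^ (k + 1))) (hj : j ∈ Finset.Icc 1 (2 ^ (k + 1))) (hij : i ≠ j) :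
    3 * radius (k + 1) ≤ dist (child c k i) (child c k j) := by
  have hN : (4 : ℝ) ≤ 2 ^ (k + 1) := by
    calc (4 : ℝ) = 2 ^ 2 := by norm_num
      _ ≤ _ := pow_le_pow_right₀ one_le_two (by omega)
  rw [Finset.mem_Icc] at hi hj
  have hi1 : (1 : ℝ) ≤ i := by exact_mod_cast hi.1
  have hi2 : (i : ℝ) ≤ 2 ^ (k + 1) := by exact_mod_cast hi.2
  have hj1 : (1 : ℝ) ≤ j := by exact_mod_cast hj.1
  have hj2 : (j : ℝ) ≤ 2 ^ (k + 1) := by exact_mod_cast hj.2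
  have hij1 : (1 : ℝ) ≤ |(i : ℝ) - j| := by
    have : (1 : ℤ) ≤ |(i : ℤ) - j| := Int.one_le_abs (by omega)
    exact_mod_cast this
  have hs := two_div_le_abs_sin (N := 2 ^ (k + 1)) (t := (i : ℝ) - j) (by linarith) hij1
    (abs_le.2 ⟨by linarith, by linarith⟩)
  rw [dist_eq_norm, norm_child_sub_child, radius_succ hk]
  have hr := radius_pos k
  set N : ℝ := 2 ^ (k + 1)
  have hN' : 1 / N ≤ 1 / 4 := one_div_le_one_div_of_le (by norm_num) hN
  calc 3 * (radius k / N) = radius k * (3 / 4) * (2 * (2 / N)) := by ring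
    _ ≤ _ := by
      gcongr
      · exact mul_nonneg hr.le (by linarith)
      · linarith

/-- The balls of one level are far apart from each other. -/
lemma pairwiseDisjoint_closedBall_desc {k : ℕ} (hk : 1 ≤ k) (c : ℂ) (d : ℕ) {l : ℝ} (hl : 1 ≤ l)
    (hl' : l < 3 / 2) :
    (desc c k d : Set ℂ).PairwiseDisjoint fun x => closedBall x (l * radius (k + d)) := by
  induction d generalizing c k with
  | zero => simp [desc]
  | succ d ih =>
    intro x hx y hy hxy
    obtain ⟨i, hi, hx'⟩ := mem_desc_succ.1 (Finset.mem_coe.1 hx)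
    obtain ⟨j, hj, hy'⟩ := mem_desc_succ.1 (Finset.mem_coe.1 hy)
    simp only [Function.onFun]
    rw [show k + (d + 1) = k + 1 + d by ring]
    by_cases hij : i = j
    · subst hij
      exact ih (by omega) _ hx' hy' hxy
    · refine Disjoint.mono (closedBall_desc_subset (by omega) hx' hl)
        (closedBall_desc_subset (by omega) hy' hl) (closedBall_disjoint_closedBall ?_)
      have := three_mul_radius_le hk c hi hj hij
      have hr := radius_pos (k + 1)
      nlinarith

/-- The sum of the radii is passed on from parent to children. The inequality suffices for the upper
bounds and does not need distinctness of the centres. -/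
lemma card_desc_mul_radius_le {k : ℕ} (hk : 1 ≤ k) (c : ℂ) (d : ℕ) :
    (desc c k d).card * radius (k + d) ≤ radius k := by
  induction d generalizing c k with
  | zero => simp [desc]
  | succ d ih =>
    have h1 : ((desc c k (d + 1)).card : ℝ) ≤
        ∑ j ∈ Finset.Icc 1 (2 ^ (k + 1)), ((desc (child c k j) (k + 1) d).card : ℝ) := by
      rw [desc]; exact_mod_cast Finset.card_biUnion_le
    calc ((desc c k (d + 1)).card : ℝ) * radius (k + (d + 1))
        ≤ (∑ j ∈ Finset.Icc 1 (2 ^ (k + 1)), ((desc (child c k j) (k + 1) d).card : ℝ)) *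
          radius (k + (d + 1)) := mul_le_mul_of_nonneg_right h1 (radius_pos _).le
      _ = ∑ j ∈ Finset.Icc 1 (2 ^ (k + 1)), ((desc (child c k j) (k + 1) d).card : ℝ) *
          radius (k + 1 + d) := by
        rw [Finset.sum_mul, show k + (d + 1) = k + 1 + d by ring]
      _ ≤ ∑ j ∈ Finset.Icc 1 (2 ^ (k + 1)), radius (k + 1) :=
        Finset.sum_le_sum fun j _ => ih (by omega) _
      _ = radius k := by
        rw [Finset.sum_const, Nat.card_Icc, radius_eq_pow_mul hk]
        simp

/-! ### The levels as unions of discs; topology of the limit set -/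

lemma wordMap_congr {j j' : ℕ → ℕ} : ∀ {k : ℕ}, (∀ i, 2 ≤ i → i ≤ k → j i = j' i) →
    wordMap j k = wordMap j' k
  | 0, _ => rfl
  | 1, _ => rfl
  | k + 2, h => by
    rw [wordMap, wordMap, wordMap_congr fun i h1 h2 => h i h1 (by omega),
      h (k + 2) (by omega) le_rfl]

lemma affine_f {k : ℕ} (hk : 1 ≤ k) (c z : ℂ) (j : ℕ) :
    c + (radius k : ℂ) * f (k + 1) j z = child c k j + (radius (k + 1) : ℂ) * z := by
  rw [child, f, radius_succ hk]
  have : (j : ℂ) * (2 / 2 ^ (k + 1)) * π * Complex.I =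
      ((2 * π * j / 2 ^ (k + 1) : ℝ) : ℂ) * Complex.I := by
    push_cast; ring
  rw [this]
  push_cast
  ring

lemma exists_wordMap_eq (d : ℕ) (j : ℕ → ℕ) :
    ∃ y, ∀ z, wordMap j (d + 1) z = y + (radius (d + 1) : ℂ) * z := by
  induction d with
  | zero => exact ⟨0, fun z => by simp [wordMap, radius]⟩
  | succ d ih =>
    obtain ⟨y, hy⟩ := ih
    exact ⟨child y (d + 1) (j (d + 2)), fun z => by
      rw [wordMap, Function.comp_apply, hy, affine_f (by omega)]⟩

lemma mem_desc_iff {d : ℕ} {c : ℂ} : c ∈ desc 0 1 d ↔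
    ∃ j : ℕ → ℕ, (∀ i, 2 ≤ i → i ≤ d + 1 → 1 ≤ j i ∧ j i ≤ 2 ^ i) ∧
      ∀ z, wordMap j (d + 1) z = c + (radius (d + 1) : ℂ) * z := by
  induction d generalizing c with
  | zero =>
    simp only [desc, Finset.mem_singleton, wordMap, radius]
    constructor
    · rintro rfl
      exact ⟨fun _ => 1, fun i h1 h2 => by omega, fun z => by simp⟩
    · rintro ⟨j, -, h⟩
      simpa using (h 0).symm
  | succ d ih =>
    rw [mem_desc_succ']
    constructor
    · rintro ⟨y, hy, i, hi, rfl⟩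
      obtain ⟨j, hj, hw⟩ := ih.1 hy
      rw [Finset.mem_Icc] at hi
      refine ⟨Function.update j (d + 2) i, fun l h1 h2 => ?_, fun z => ?_⟩
      · by_cases hl : l = d + 2
        · subst hl
          rw [Function.update_self]
          rwa [show 1 + d + 1 = d + 2 by ring] at hi
        · rw [Function.update_of_ne hl]
          exact hj l h1 (by omega)
      · rw [wordMap, Function.comp_apply, Function.update_self,
          wordMap_congr (j' := j) fun l h1 h2 => Function.update_of_ne (by omega) _ _, hw,
          affine_f (by omega), show 1 + d = d + 1 by ring]
    · rintro ⟨j, hj, hw⟩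
      have hj2 := hj (d + 2) (by omega) (by omega)
      obtain ⟨y, hy⟩ := exists_wordMap_eq d j
      refine ⟨y, ih.2 ⟨j, fun i h1 h2 => hj i h1 (by omega), hy⟩, j (d + 2), ?_, ?_⟩
      · rw [Finset.mem_Icc, show 1 + d + 1 = d + 2 by ring]; exact hj2
      · have := hw 0
        rw [wordMap, Function.comp_apply, hy, affine_f (by omega)] at this
        rw [show 1 + d = d + 1 by ring]
        simpa using this.symm

lemma image_affine_closedBall (c : ℂ) {r : ℝ} (hr : 0 < r) :
    (fun z => c + (r : ℂ) * z) '' closedBall 0 1 = closedBall c r := by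
  ext x
  simp only [mem_image, mem_closedBall, dist_eq_norm, sub_zero]
  constructor
  · rintro ⟨z, hz, rfl⟩
    rw [add_sub_cancel_left, norm_mul, Complex.norm_real, Real.norm_of_nonneg hr.le]
    exact mul_le_of_le_one_right hr.le hz
  · intro hx
    have hr' : (r : ℂ) ≠ 0 := by exact_mod_cast hr.ne'
    refine ⟨(x - c) / r, ?_, ?_⟩
    · rw [norm_div, Complex.norm_real, Real.norm_of_nonneg hr.le]
      exact div_le_one_of_le₀ hx hr.le
    · field_simp; ring

lemma level_succ (d : ℕ) : level (d + 1) = ⋃ c ∈ desc 0 1 d, closedBall c (radius (d + 1)) := by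
  ext x
  simp only [level, mem_iUnion, exists_prop, mem_ofPred_eq]
  constructor
  · rintro ⟨j, hj, hx⟩
    obtain ⟨y, hy⟩ := exists_wordMap_eq d j
    refine ⟨y, mem_desc_iff.2 ⟨j, hj, hy⟩, ?_⟩
    rwa [funext hy, image_affine_closedBall y (radius_pos _)] at hx
  · rintro ⟨c, hc, hx⟩
    obtain ⟨j, hj, hy⟩ := mem_desc_iff.1 hc
    refine ⟨j, hj, ?_⟩
    rwa [funext hy, image_affine_closedBall c (radius_pos _)]

lemma level_succ_subset (d : ℕ) : level (d + 1 + 1) ⊆ level (d + 1) := by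
  rw [level_succ, level_succ]
  refine iUnion₂_subset fun c hc => ?_
  obtain ⟨y, hy, j, -, rfl⟩ := mem_desc_succ'.1 hc
  refine subset_trans ?_ (subset_iUnion₂ (s := fun c _ => closedBall c (radius (d + 1))) y hy)
  have := closedBall_child_subset (k := d + 1) (by omega) y j le_rfl
  simpa [add_comm 1 d] using this

lemma isCompact_level (d : ℕ) : IsCompact (level (d + 1)) := by
  rw [level_succ]
  exact (desc 0 1 d).isCompact_biUnion fun c _ => isCompact_closedBall c _

lemma antitone_level : Antitone fun d => level (d + 1) := antitone_nat_of_succ_le level_succ_subset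

lemma circlesOfBalls_eq : circlesOfBalls = ⋂ d, level (d + 1) := by
  ext x
  simp only [circlesOfBalls, mem_iInter, mem_ofPred_eq]
  constructor
  · exact fun h d => h (d + 1) (by omega)
  · intro h k hk
    obtain ⟨d, rfl⟩ := Nat.exists_eq_add_of_le' hk
    exact h d

lemma circlesOfBalls_subset_level (d : ℕ) : circlesOfBalls ⊆ level (d + 1) := by
  rw [circlesOfBalls_eq]; exact iInter_subset _ d

lemma isCompact_circlesOfBalls : IsCompact circlesOfBalls := by
  rw [circlesOfBalls_eq]
  exact (isCompact_level 0).of_isClosed_subset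
    (isClosed_iInter fun d => (isCompact_level d).isClosed) (iInter_subset _ 0)

/-- Compactness of the decreasing levels: a neighbourhood of the limit set already contains one of
them. -/
lemma exists_level_subset {U : Set ℂ} (hU : IsOpen U) (h : circlesOfBalls ⊆ U) :
    ∃ d, level (d + 1) ⊆ U :=
  exists_subset_nhds_of_isCompact antitone_level.directed_ge isCompact_level fun x hx =>
    hU.mem_nhds (h (by rwa [circlesOfBalls_eq]))

/-- A connected subset lies in a single ball of every level, and the radii tend to zero. -/
lemma isTotallyDisconnected_circlesOfBalls : IsTotallyDisconnected circlesOfBalls := by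
  intro t ht hpre x hx y hy
  by_contra hxy
  have hd : 0 < dist x y := dist_pos.2 hxy
  obtain ⟨d, hd'⟩ := (tendsto_radius.eventually (gt_mem_nhds (half_pos hd))).exists
  have hsub := ht.trans (circlesOfBalls_subset_level d)
  rw [level_succ] at hsub
  have hdis := pairwiseDisjoint_closedBall_desc le_rfl 0 d (l := 1) le_rfl (by norm_num)
  simp only [one_mul, add_comm 1 d] at hdis
  obtain ⟨c, -, hc⟩ := exists_subset_of_isPreconnected hpre ⟨x, hx⟩ (desc 0 1 d) _
    (fun _ _ => isClosed_closedBall) hdis hsub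
  have h1 := mem_closedBall.1 (hc hx)
  have h2 := mem_closedBall.1 (hc hy)
  have := dist_triangle_right x y c
  linarith

/-! ### Perimeter estimates for points of a regular polygon -/

lemma sin_ge_of_mem_middle_third {x : ℝ} (h1 : π / 3 ≤ x) (h2 : x ≤ 2 * π / 3) :
    86 / 100 ≤ Real.sin x := by
  have h : Real.cos (π / 6) ≤ Real.cos |x - π / 2| :=
    Real.cos_le_cos_of_nonneg_of_le_pi (abs_nonneg _) (by linarith [Real.pi_pos])
      (abs_le.2 ⟨by linarith, by linarith⟩)
  rw [Real.cos_abs, Real.cos_sub_pi_div_two, Real.cos_pi_div_six] at h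
  refine le_trans ?_ h
  have : (172 / 100 : ℝ) ≤ √3 := Real.le_sqrt_of_sq_le (by norm_num)
  linarith

/-- Among at most half of the `N`-th roots of unity there are two whose distance is large compared
with the number of the given roots. -/
lemma exists_far_pair {N : ℕ} (hN : 16 ≤ N) {J : Finset ℕ} (hJ : J ⊆ Finset.Icc 1 N)
    (hne : J.Nonempty) (hcard : 2 * J.card ≤ N) :
    ∃ a ∈ J, ∃ b ∈ J, π * ((J.card : ℝ) - 1) / N ≤
      (1 - 1 / N) * (2 * |Real.sin (π * ((a : ℝ) - b) / N)|) := by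
  have hN' : (16 : ℝ) ≤ N := by exact_mod_cast hN
  have hN0 : (0 : ℝ) < N := by linarith
  have hfac : (15 / 16 : ℝ) ≤ 1 - 1 / N := by
    have : (1 : ℝ) / N ≤ 1 / 16 := one_div_le_one_div_of_le (by norm_num) hN'
    linarith
  -- Two indices between one and two thirds of a turn apart have a chord of at least `2 * 0.86`;
  -- with the factor `15 / 16` this exceeds `π / 2`, the most that can be required.
  by_cases hmid : ∃ a ∈ J, ∃ b ∈ J, N ≤ 3 * ((a : ℤ) - b) ∧ 3 * ((a : ℤ) - b) ≤ 2 * N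
  · obtain ⟨a, ha, b, hb, h1, h2⟩ := hmid
    refine ⟨a, ha, b, hb, ?_⟩
    have h1' : (N : ℝ) ≤ 3 * ((a : ℝ) - b) := by exact_mod_cast h1
    have h2' : 3 * ((a : ℝ) - b) ≤ 2 * N := by exact_mod_cast h2
    have hs : 86 / 100 ≤ Real.sin (π * ((a : ℝ) - b) / N) := by
      apply sin_ge_of_mem_middle_third
      · rw [div_le_div_iff₀ (by norm_num) hN0]
        nlinarith [Real.pi_pos]
      · rw [div_le_div_iff₀ hN0 (by norm_num)]
        nlinarith [Real.pi_pos]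
    have hc : (2 : ℝ) * J.card ≤ N := by exact_mod_cast hcard
    have hl : π * ((J.card : ℝ) - 1) / N ≤ π / 2 := by
      rw [div_le_div_iff₀ hN0 two_pos]
      nlinarith [Real.pi_pos]
    have hpi := Real.pi_lt_d2
    calc π * ((J.card : ℝ) - 1) / N ≤ 15 / 16 * (2 * (86 / 100)) := by linarith
      _ ≤ _ := by
        gcongr
        exact hs.trans (le_abs_self _)
  · push Not at hmid
    let a₀ := J.min' hne
    have ha₀ : a₀ ∈ J := J.min'_mem hne
    have hmem : ∀ x ∈ J, 1 ≤ x ∧ x ≤ N := fun x hx => Finset.mem_Icc.1 (hJ hx)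
    -- Without such a pair the indices lie within a third of a turn around `a₀`. Those past the
    -- wrap-around are lowered by `N`, so that `φ` lists them along one arc.
    let φ : ℕ → ℤ := fun x => if 3 * ((x : ℤ) - a₀) < N then x else (x : ℤ) - N
    have hφ : ∀ x ∈ J, (φ x = x ∧ 3 * ((x : ℤ) - a₀) < N) ∨
        (φ x = (x : ℤ) - N ∧ 2 * N < 3 * ((x : ℤ) - a₀)) := fun x hx => by
      by_cases h : 3 * ((x : ℤ) - a₀) < N
      · exact Or.inl ⟨if_pos h, h⟩
      · exact Or.inr ⟨if_neg h, hmid x hx a₀ ha₀ (not_lt.1 h)⟩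
    have hge : ∀ x ∈ J, a₀ ≤ x := fun x hx => J.min'_le x hx
    have hinj : Set.InjOn φ J := fun x hx y hy hxy => by
      have h1 := hφ x hx
      have h2 := hφ y hy
      have h3 := hmem x hx
      have h4 := hmem y hy
      omega
    have hne' : (J.image φ).Nonempty := hne.image φ
    obtain ⟨a, ha, hpa⟩ := Finset.mem_image.1 ((J.image φ).min'_mem hne')
    obtain ⟨b, hb, hqb⟩ := Finset.mem_image.1 ((J.image φ).max'_mem hne')
    have hsub : J.image φ ⊆ Finset.Icc (φ a) (φ b) := fun x hx => by
      rw [Finset.mem_Icc, hpa, hqb]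
      exact ⟨Finset.min'_le _ x hx, Finset.le_max' _ x hx⟩
    have hle : φ a ≤ φ b := by rw [hpa]; exact Finset.min'_le _ _ (Finset.mem_image_of_mem _ hb)
    have hcardle := Finset.card_le_card hsub
    rw [Finset.card_image_of_injOn hinj, Int.card_Icc] at hcardle
    have hT : 3 * (φ b - φ a) < N ∧ ((a : ℤ) - b = -(φ b - φ a) ∨ (a : ℤ) - b = N - (φ b - φ a)) := by
      have h1 := hφ a ha
      have h2 := hφ b hb
      have h3 := hge a ha
      have h4 := hge b hb
      have h5 := hmem a ha
      have h6 := hmem b hb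
      have h7 := hmid b hb a ha
      have h8 := hmid a ha b hb
      omega
    obtain ⟨hT3, hTab⟩ := hT
    generalize hTdef : φ b - φ a = T at hT3 hTab
    have hT0 : 0 ≤ T := by omega
    -- Distinct integers in an interval spread at least as far as their number less one. Jordan's
    -- inequality at the two ends then gives `15 / 4 > π` per step.
    have hTc : (J.card : ℤ) - 1 ≤ T := by omega
    have hT0' : (0 : ℝ) ≤ T := by exact_mod_cast hT0
    have hTc' : (J.card : ℝ) - 1 ≤ T := by exact_mod_cast hTc
    have hT3' : 3 * (T : ℝ) < N := by exact_mod_cast hT3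
    refine ⟨a, ha, b, hb, ?_⟩
    have hs := two_div_mul_le_sin hN0 hT0' (by linarith)
    have hs' : |Real.sin (π * ((a : ℝ) - b) / N)| = |Real.sin (π * T / N)| := by
      rcases hTab with h | h
      · have h' : (a : ℝ) - b = -T := by exact_mod_cast h
        rw [h', mul_neg, neg_div, Real.sin_neg, abs_neg]
      · have h' : (a : ℝ) - b = N - T := by exact_mod_cast h
        rw [h', show π * (N - T) / N = π - π * T / N by field_simp, Real.sin_pi_sub]
    rw [hs']
    have hpi := Real.pi_lt_d2
    calc π * ((J.card : ℝ) - 1) / N ≤ (15 / 4) * T / N := by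
          refine div_le_div_of_nonneg_right ?_ hN0.le
          have := mul_le_mul_of_nonneg_left hTc' Real.pi_pos.le
          nlinarith
      _ = 15 / 16 * (2 * (2 * T / N)) := by ring
      _ ≤ _ := by
        gcongr
        exact hs.trans (le_abs_self _)

/-- Pigeonhole on the `M` residue classes modulo `M`. -/
lemma exists_antipodal_pair {M : ℕ} {J : Finset ℕ} (hJ : J ⊆ Finset.Icc 1 (2 * M))
    (hcard : M < J.card) : ∃ j ∈ J, j + M ∈ J := by
  have hmem : ∀ x ∈ J, 1 ≤ x ∧ x ≤ 2 * M := fun x hx => Finset.mem_Icc.1 (hJ hx)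
  obtain ⟨x, hx, y, hy, hxy, h⟩ := Finset.exists_ne_map_eq_of_card_lt_of_maps_to
    (s := J) (t := Finset.Icc 1 M) (f := fun x => if x ≤ M then x else x - M) (by simpa using hcard)
    (fun x hx => by
      have := hmem x hx
      simp only [Finset.coe_Icc, mem_Icc]
      split_ifs <;> omega)
  have h1 := hmem x hx
  have h2 := hmem y hy
  split_ifs at h with h3 h4 h4
  · exact absurd h hxy
  · exact ⟨x, hx, by rwa [show x + M = y by omega]⟩
  · exact ⟨y, hy, by rwa [show y + M = x by omega]⟩
  · omega

/-- A set that meets discs around more than half of the points of a regular polygon has a hull of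
almost proportional perimeter. -/
lemma le_hullPerimeter_of_many {A : Set ℂ} (hA : IsBounded A) {c : ℂ} {r : ℝ} (hr : 0 < r)
    {M N : ℕ} (hM : 8 ≤ M) (hN : N = 2 * M) {J : Finset ℕ} (hJ : J ⊆ Finset.Icc 1 N)
    (hcard : M < J.card)
    (hz : ∀ j ∈ J, ∃ z ∈ A, z ∈ closedBall (c + ((r * (1 - 1 / N) : ℝ) : ℂ) *
      Complex.exp (((2 * π * j / N : ℝ) : ℂ) * Complex.I)) (r / N)) :
    2 * π * (1 - 4 / N) * r * (J.card / N) ≤ hullPerimeter A := by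
  have hN16 : (16 : ℝ) ≤ N := by
    have : 16 ≤ N := by omega
    exact_mod_cast this
  have hN0 : (0 : ℝ) < N := by linarith
  have hN1 : 1 / (N : ℝ) ≤ 1 / 16 := one_div_le_one_div_of_le (by norm_num) hN16
  have hNM : (N : ℝ) = 2 * M := by rw [hN]; push_cast; ring
  have hM0 : (0 : ℝ) < M := by linarith
  set R := r * (1 - 1 / N) with hR
  have hR0 : 0 ≤ R := mul_nonneg hr.le (by linarith)
  have hlow : ∀ j ∈ J, ∀ θ, proj θ c + R * Real.cos (θ - 2 * π * j / N) - r / N ≤ support A θ := by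
    intro j hj θ
    obtain ⟨z, hzA, hzb⟩ := hz j hj
    rw [mem_closedBall, dist_eq_norm, ← norm_neg] at hzb
    have h1 := proj_le_support hA θ hzA
    have h2 := (proj_le θ _).trans hzb
    rw [map_neg, map_sub, map_add, proj_mul_exp] at h2
    linarith
  obtain ⟨j₀, hj₀, hj₁⟩ := exists_antipodal_pair (hN ▸ hJ) hcard
  have hne : A.Nonempty := let ⟨z, hz, _⟩ := hz j₀ hj₀; ⟨z, hz⟩
  -- The support function seen from `c`, raised by the disc radius so that exact polygon vertices
  -- bound it from below.
  let g : ℝ → ℝ := fun θ => support A θ - proj θ c + r / N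
  have hgc : Continuous g :=
    ((continuous_support hA hne).sub (continuous_proj_left c)).add continuous_const
  have hgi : ∀ a b, IntervalIntegrable g volume a b := fun a b => hgc.intervalIntegrable a b
  have hgp : Function.Periodic g (2 * π) := fun θ => by
    simp only [g, support_add_two_pi, proj_add_two_pi]
  -- Antipodal vertices give the lower bounds `R * cos` and `-R * cos`, whose average is zero. This
  -- lets the arcs without a point of `J` be dropped.
  have hg0 : ∀ θ, 0 ≤ g θ := fun θ => by
    have h1 := hlow j₀ hj₀ θ
    have h2 := hlow _ hj₁ θ
    have e : θ - 2 * π * ((j₀ + M : ℕ) : ℝ) / N = θ - 2 * π * j₀ / N - π := by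
      rw [hNM]; push_cast; field_simp; ring
    rw [e, Real.cos_sub_pi] at h2
    simp only [g]
    nlinarith
  have hint : ∫ θ in (0)..(2 * π), g θ = hullPerimeter A + 2 * π * (r / N) := by
    have hi := intervalIntegrable_support hA hne 0 (2 * π)
    have hi' : IntervalIntegrable (fun θ => proj θ c) volume 0 (2 * π) :=
      (continuous_proj_left c).intervalIntegrable _ _
    simp only [g]
    rw [intervalIntegral.integral_add (hi.sub hi') (by simp), intervalIntegral.integral_sub hi hi',
      integral_proj, intervalIntegral.integral_const]
    simp [hullPerimeter]
  -- Endpoints of the arcs of half-width `π / N` around the vertices; the arc from `a i` to `a (i +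
  -- 1)` is centred at vertex `i + 1`.
  let a : ℕ → ℝ := fun i => (2 * i + 1) * π / N
  have ha : ∀ i, a (i + 1) - a i = 2 * π / N := fun i => by
    simp only [a]; push_cast; field_simp; ring
  have hsum : ∑ i ∈ Finset.range N, ∫ θ in a i..a (i + 1), g θ = ∫ θ in (0)..(2 * π), g θ := by
    rw [intervalIntegral.sum_integral_adjacent_intervals fun i _ => hgi _ _]
    have e : a N = a 0 + 2 * π := by simp only [a]; push_cast; field_simp; ring
    rw [e, hgp.intervalIntegral_add_eq (a 0) 0, zero_add]
  let v := 2 * π / N * (R * Real.cos (π / N))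
  have hcospos : 0 ≤ Real.cos (π / N) := Real.cos_nonneg_of_mem_Icc ⟨by
      have : 0 < π / N := by positivity
      linarith [Real.pi_pos], by
      gcongr; linarith⟩
  have harc : ∀ i ∈ Finset.range N, (if i + 1 ∈ J then v else 0) ≤ ∫ θ in a i..a (i + 1), g θ := by
    intro i _
    have hle : a i ≤ a (i + 1) := by
      have : 0 < 2 * π / N := by positivity
      linarith [ha i]
    split_ifs with hi
    · have : ∫ _ in a i..a (i + 1), R * Real.cos (π / N) ≤ ∫ θ in a i..a (i + 1), g θ := by
        refine intervalIntegral.integral_mono_on hle (by simp) (hgi _ _) fun θ hθ => ?_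
        have h1 := hlow _ hi θ
        have h2 : Real.cos (π / N) ≤ Real.cos (θ - 2 * π * ((i + 1 : ℕ) : ℝ) / N) := by
          rw [← Real.cos_abs (θ - _)]
          refine Real.cos_le_cos_of_nonneg_of_le_pi (abs_nonneg _)
            (div_le_self Real.pi_pos.le (by linarith)) (abs_le.2 ?_)
          have e1 : a i = 2 * π * ((i + 1 : ℕ) : ℝ) / N - π / N := by
            simp only [a]; push_cast; ring
          have e2 : a (i + 1) = 2 * π * ((i + 1 : ℕ) : ℝ) / N + π / N := by
            simp only [a]; push_cast; ring
          rw [e1, e2] at hθ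
          exact ⟨by linarith [hθ.1], by linarith [hθ.2]⟩
        have h3 := mul_le_mul_of_nonneg_left h2 hR0
        simp only [g]; linarith
      rw [intervalIntegral.integral_const, ha, smul_eq_mul] at this
      exact this
    · exact intervalIntegral.integral_nonneg hle fun θ _ => hg0 θ
  have htot : J.card * v ≤ hullPerimeter A + 2 * π * (r / N) := by
    rw [← hint, ← hsum]
    refine le_trans (le_of_eq ?_) (Finset.sum_le_sum harc)
    rw [Finset.range_eq_Ico, Finset.sum_Ico_add' (fun i => if i ∈ J then v else 0) 0 N 1,
      Finset.sum_ite_mem, Finset.inter_eq_right.2, Finset.sum_const, nsmul_eq_mul]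
    intro j hj
    have := Finset.mem_Icc.1 (hJ hj)
    rw [Finset.mem_Ico]; omega
  have hcos : 1 - 1 / (N : ℝ) ≤ Real.cos (π / N) := by
    refine le_trans ?_ Real.one_sub_sq_div_two_le_cos
    have hpi := Real.pi_lt_d2
    have : (π / N) ^ 2 / 2 ≤ 1 / N := by
      rw [div_pow, div_div, div_le_div_iff₀ (by positivity) hN0]
      have hpi2 : π ^ 2 ≤ 10 := by nlinarith [Real.pi_pos]
      nlinarith
    linarith
  have hmN : (1 / 2 : ℝ) ≤ J.card / N := by
    rw [div_le_div_iff₀ two_pos hN0, hNM]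
    have : (M : ℝ) ≤ J.card := by exact_mod_cast hcard.le
    linarith
  have hv : 2 * π * r * ((J.card / N) * ((1 - 1 / N) * (1 - 1 / N))) ≤ J.card * v := by
    calc 2 * π * r * ((J.card / N : ℝ) * ((1 - 1 / N) * (1 - 1 / N)))
        ≤ 2 * π * r * ((J.card / N : ℝ) * ((1 - 1 / N) * Real.cos (π / N))) := by
          gcongr; linarith
      _ = _ := by simp only [v, hR]; ring
  -- The additive loss `1 / N` is at most `2 / N` times the proportion, because the proportion is at
  -- least `1 / 2`.
  have hfin : (1 - 4 / N) * (J.card / N : ℝ) ≤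
      (J.card / N) * ((1 - 1 / N) * (1 - 1 / N)) - 1 / N := by
    generalize (J.card / N : ℝ) = s at hmN
    rw [show (4 : ℝ) / N = 4 * (1 / N) by ring]
    have hx : 0 ≤ 1 / (N : ℝ) := by positivity
    generalize 1 / (N : ℝ) = x at hx
    nlinarith [mul_nonneg hx (sub_nonneg.2 hmN), mul_nonneg (mul_nonneg hx hx) (le_trans (by norm_num) hmN)]
  calc 2 * π * (1 - 4 / N) * r * (J.card / N)
      = 2 * π * r * ((1 - 4 / N) * (J.card / N : ℝ)) := by ring
    _ ≤ 2 * π * r * ((J.card / N) * ((1 - 1 / N) * (1 - 1 / N)) - 1 / N) := by gcongr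
    _ = 2 * π * r * ((J.card / N) * ((1 - 1 / N) * (1 - 1 / N))) - 2 * π * (r / N) := by ring
    _ ≤ _ := by linarith

/-! ### Mass and its comparison with the perimeter -/

open Classical in
/-- The proportion of the balls of level `k + d` in the ball of level `k` with centre `c` that are
contained in `A`. -/
noncomputable def mass (A : Set ℂ) : ℂ → ℕ → ℕ → ℝ
  | c, k, 0 => if closedBall c (radius k) ⊆ A then 1 else 0
  | c, k, d + 1 => (∑ j ∈ Finset.Icc 1 (2 ^ (k + 1)), mass A (child c k j) (k + 1) d) / 2 ^ (k + 1)

lemma mass_nonneg (A : Set ℂ) (c : ℂ) (k d : ℕ) : 0 ≤ mass A c k d := by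
  induction d generalizing c k with
  | zero => rw [mass]; split_ifs <;> norm_num
  | succ d ih => rw [mass]; exact div_nonneg (Finset.sum_nonneg fun j _ => ih _ _) (by positivity)

lemma mass_le_one (A : Set ℂ) (c : ℂ) (k d : ℕ) : mass A c k d ≤ 1 := by
  induction d generalizing c k with
  | zero => rw [mass]; split_ifs <;> norm_num
  | succ d ih =>
    rw [mass, div_le_one (by positivity)]
    refine (Finset.sum_le_sum fun j _ => ih _ _).trans ?_
    simp

lemma mass_congr {A B : Set ℂ} {c : ℂ} {k : ℕ} (hk : 1 ≤ k) (d : ℕ)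
    (h : ∀ z ∈ closedBall c (radius k), z ∈ A ↔ z ∈ B) : mass A c k d = mass B c k d := by
  induction d generalizing c k with
  | zero =>
    rw [mass, mass]
    congr 1
    exact propext ⟨fun h' z hz => (h z hz).1 (h' hz), fun h' z hz => (h z hz).2 (h' hz)⟩
  | succ d ih =>
    rw [mass, mass]
    congr 1
    refine Finset.sum_congr rfl fun j _ => ih (by omega) fun z hz => h z ?_
    have := closedBall_child_subset hk c j le_rfl
    simp only [one_mul] at this
    exact this hz

/-- Mass below a ball only sees the part of the set inside it, so an induction hypothesis about `A`
can be applied to a piece of `A`. -/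
lemma mass_inter_closedBall (A : Set ℂ) (c : ℂ) {k : ℕ} (hk : 1 ≤ k) (d : ℕ) :
    mass (A ∩ closedBall c (radius k)) c k d = mass A c k d :=
  mass_congr hk d fun z hz => by simp only [mem_inter_iff, hz, and_true]

lemma mass_empty (c : ℂ) (k d : ℕ) : mass ∅ c k d = 0 := by
  induction d generalizing c k with
  | zero =>
    rw [mass, if_neg]
    exact fun h => h (mem_closedBall_self (radius_pos k).le)
  | succ d ih => rw [mass, Finset.sum_eq_zero fun j _ => ih _ _, zero_div]

lemma inter_nonempty_of_mass_ne_zero {A : Set ℂ} {c : ℂ} {k d : ℕ} (hk : 1 ≤ k)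
    (h : mass A c k d ≠ 0) : (A ∩ closedBall c (radius k)).Nonempty := by
  by_contra hne
  rw [not_nonempty_iff_eq_empty] at hne
  rw [← mass_inter_closedBall A c hk, hne] at h
  exact h (mass_empty _ _ _)

/-- Mass is an average over the tree, so subadditivity reduces to the leaves, each of which is
contained in some `D i`. -/
lemma one_le_sum_mass {ι : Type*} (s : Finset ι) (D : ι → Set ℂ) {c : ℂ} {k d : ℕ}
    (h : ∀ x ∈ desc c k d, ∃ i ∈ s, closedBall x (radius (k + d)) ⊆ D i) :
    1 ≤ ∑ i ∈ s, mass (D i) c k d := by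
  induction d generalizing c k with
  | zero =>
    obtain ⟨i, hi, hsub⟩ := h c (by simp [desc])
    refine le_trans (le_of_eq ?_) (Finset.single_le_sum (fun i _ => mass_nonneg (D i) c k 0) hi)
    rw [mass, if_pos (by simpa using hsub)]
  | succ d ih =>
    simp only [mass]
    rw [← Finset.sum_div, le_div_iff₀ (by positivity), one_mul, Finset.sum_comm]
    calc (2 : ℝ) ^ (k + 1) = ∑ j ∈ Finset.Icc 1 (2 ^ (k + 1)), 1 := by simp
      _ ≤ _ := Finset.sum_le_sum fun j hj => ih fun x hx => by
        have := h x (mem_desc_succ.2 ⟨j, hj, hx⟩)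
        rwa [show k + (d + 1) = k + 1 + d by ring] at this

lemma one_sub_two_div_pow_nonneg {k : ℕ} (hk : 1 ≤ k) : (0 : ℝ) ≤ 1 - 2 / 2 ^ k := by
  rw [sub_nonneg, div_le_one (by positivity)]
  simpa using pow_le_pow_right₀ (one_le_two (α := ℝ)) hk

/-- The perimeter of the hull of a small set dominates the mass of the set. -/
lemma mass_le_hullPerimeter {k₀ : ℕ} (hk₀ : 3 ≤ k₀) (d : ℕ) {A : Set ℂ} (hA : IsBounded A)
    (hdiam : diam A < radius k₀) (c : ℂ) {k : ℕ} (hk : 1 ≤ k) :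
    2 * π * (1 - 2 / 2 ^ k₀) * (radius k * mass A c k d) ≤ hullPerimeter A := by
  have hq0 := one_sub_two_div_pow_nonneg (k := k₀) (by omega)
  have hq1 : (1 : ℝ) - 2 / 2 ^ k₀ ≤ 1 := by
    have : (0 : ℝ) ≤ 2 / 2 ^ k₀ := by positivity
    linarith
  induction d generalizing A c k with
  | zero =>
    rw [mass]
    have hr := radius_pos k
    split_ifs with h
    · refine le_trans ?_ ((le_hullPerimeter_closedBall c hr.le).trans
        (hullPerimeter_mono ⟨c, mem_closedBall_self hr.le⟩ hA h))
      have : 0 ≤ 2 * π * radius k := by positivity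
      nlinarith
    · rw [mul_zero, mul_zero]
      exact hullPerimeter_nonneg hA
  | succ d ih =>
    set q : ℝ := 1 - 2 / 2 ^ k₀ with hq
    let ρ := radius (k + 1)
    have hρ : 0 < ρ := radius_pos _
    let m : ℕ → ℝ := fun j => mass A (child c k j) (k + 1) d
    let a : ℕ → Set ℂ := fun j => A ∩ closedBall (child c k j) ρ
    have hm0 : ∀ j, 0 ≤ m j := fun j => mass_nonneg _ _ _ _
    have hm1 : ∀ j, m j ≤ 1 := fun j => mass_le_one _ _ _ _
    let J := (Finset.Icc 1 (2 ^ (k + 1))).filter fun j => m j ≠ 0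
    have hJsub : J ⊆ Finset.Icc 1 (2 ^ (k + 1)) := Finset.filter_subset _ _
    have hane : ∀ j ∈ J, (a j).Nonempty := fun j hj =>
      inter_nonempty_of_mass_ne_zero (by omega) (Finset.mem_filter.1 hj).2
    have hsumJ : radius k * mass A c k (d + 1) = ρ * ∑ j ∈ J, m j := by
      have h1 : ∑ j ∈ Finset.Icc 1 (2 ^ (k + 1)), m j = ∑ j ∈ J, m j :=
        (Finset.sum_filter_ne_zero _).symm
      rw [mass, ← h1, radius_eq_pow_mul hk]
      field_simp
      rfl
    rw [hsumJ]
    have haA : ∀ j, a j ⊆ A := fun j => inter_subset_left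
    have hIH : ∀ j, 2 * π * q * (ρ * m j) ≤ hullPerimeter (a j) := fun j => by
      have := ih (A := a j) (hA.subset (haA j)) ((diam_mono (haA j) hA).trans_lt hdiam)
        (child c k j) (k := k + 1) (by omega)
      rwa [mass_inter_closedBall _ _ (by omega)] at this
    have hmono : ∀ j ∈ J, hullPerimeter (a j) ≤ hullPerimeter A := fun j hj =>
      hullPerimeter_mono (hane j hj) hA (haA j)
    rcases lt_or_ge J.card 2 with hcard | hcard
    · rcases Nat.lt_succ_iff.1 hcard |>.lt_or_eq with h0 | h1
      · rw [Finset.card_eq_zero.1 (Nat.lt_one_iff.1 h0), Finset.sum_empty, mul_zero, mul_zero]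
        exact hullPerimeter_nonneg hA
      · obtain ⟨j, hj⟩ := Finset.card_eq_one.1 h1
        rw [hj, Finset.sum_singleton]
        exact (hIH j).trans (hmono j (by simp [hj]))
    -- Centres at least `3 * ρ` apart, less one radius at each end.
    have hsep : ∀ i ∈ J, ∀ j ∈ J, i ≠ j → ρ ≤ diam A := fun i hi j hj hij => by
      obtain ⟨z, hzA, hz⟩ := hane i hi
      obtain ⟨w, hwA, hw⟩ := hane j hj
      have h1 := three_mul_radius_le hk c (hJsub hi) (hJsub hj) hij
      have h2 := dist_le_diam_of_mem hA hzA hwA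
      have h3 := dist_triangle4 (child c k i) z w (child c k j)
      rw [mem_closedBall] at hz hw
      rw [dist_comm] at hz
      change 3 * ρ ≤ _ at h1
      linarith
    -- The only use of the small diameter: a set that reaches two children must be in a deep
    -- generation, where the polygon estimates lose at most the factor `q`.
    have hkk : k₀ ≤ k := by
      by_contra hlt
      obtain ⟨i, hi, j, hj, hij⟩ := Finset.one_lt_card.1 hcard
      have := hsep i hi j hj hij
      have h2 : radius k₀ ≤ ρ := radius_antitone (by omega) (by omega)
      linarith
    have hN16 : 16 ≤ 2 ^ (k + 1) := by
      calc 16 = 2 ^ 4 := by norm_num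
        _ ≤ _ := Nat.pow_le_pow_right two_pos (by omega)
    have hrρ : radius k * (1 / 2 ^ (k + 1)) = ρ := by
      simp only [ρ]; rw [radius_succ hk]; ring
    rcases le_or_gt (2 * J.card) (2 ^ (k + 1)) with hfew | hmany
    · obtain ⟨i, hi, j, hj, hij⟩ := exists_far_pair hN16 hJsub
        (Finset.card_pos.1 (by omega)) hfew
      have hcardR : (2 : ℝ) ≤ J.card := by exact_mod_cast hcard
      have hne : j ≠ i := by
        rintro rfl
        rw [sub_self, mul_zero, zero_div, Real.sin_zero, abs_zero, mul_zero, mul_zero] at hij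
        have : 0 < π * ((J.card : ℝ) - 1) / ((2 ^ (k + 1) : ℕ) : ℝ) := by
          have : 0 < (J.card : ℝ) - 1 := by linarith
          positivity
        linarith
      have hdist : π * ((J.card : ℝ) - 1) * ρ ≤ ‖child c k i - child c k j‖ := by
        rw [norm_child_sub_child, ← hrρ]
        push_cast at hij
        have := mul_le_mul_of_nonneg_left hij (radius_pos k).le
        calc π * ((J.card : ℝ) - 1) * (radius k * (1 / 2 ^ (k + 1)))
            = radius k * (π * ((J.card : ℝ) - 1) / 2 ^ (k + 1)) := by ring
          _ ≤ _ := this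
          _ = _ := by ring
      have hP := hullPerimeter_add_le hA (haA j) (haA i) (hane j hj) (hane i hi)
        (inter_subset_right (s := A)) (inter_subset_right (s := A))
      -- Only the two far pieces keep their actual mass; the others are counted as full and paid for
      -- by the distance.
      have hsplit : ∑ l ∈ J, m l ≤ m j + m i + ((J.card : ℝ) - 2) := by
        have hi' : i ∈ J.erase j := Finset.mem_erase.2 ⟨hne.symm, hi⟩
        rw [← Finset.add_sum_erase J m hj, ← Finset.add_sum_erase (J.erase j) m hi', add_assoc]
        have h1 : ∑ l ∈ (J.erase j).erase i, m l ≤ ((J.erase j).erase i).card := by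
          refine (Finset.sum_le_sum fun l _ => hm1 l).trans ?_
          simp
        rw [Finset.card_erase_of_mem hi', Finset.card_erase_of_mem hj] at h1
        have e : ((J.card - 1 - 1 : ℕ) : ℝ) = (J.card : ℝ) - 2 := by
          rw [Nat.sub_sub, Nat.cast_sub hcard]; norm_num
        rw [e] at h1
        linarith
      have h1 := hIH i
      have h2 := hIH j
      have hpρ : 0 ≤ 2 * π * ρ := by positivity
      calc 2 * π * q * (ρ * ∑ l ∈ J, m l)
          ≤ 2 * π * q * (ρ * (m j + m i + ((J.card : ℝ) - 2))) := by gcongr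
        _ = 2 * π * q * (ρ * m j) + 2 * π * q * (ρ * m i) +
            q * (2 * π * ρ * ((J.card : ℝ) - 2)) := by ring
        _ ≤ hullPerimeter (a j) + hullPerimeter (a i) + 1 * (2 * π * ρ * ((J.card : ℝ) - 2)) := by
          gcongr
        _ ≤ _ := by
          simp only [ρ] at hdist hP ⊢
          linarith
    · have hr := radius_pos k
      have hcast : ((2 ^ (k + 1) : ℕ) : ℝ) = 2 ^ (k + 1) := by push_cast; rfl
      have hmain := le_hullPerimeter_of_many hA (c := c) hr (M := 2 ^ k) (N := 2 ^ (k + 1))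
        (by omega) (by ring) hJsub (by omega) (fun j hj => by
          obtain ⟨z, hz⟩ := hane j hj
          refine ⟨z, hz.1, ?_⟩
          rw [hcast, ← radius_succ hk]
          exact hz.2)
      refine le_trans ?_ hmain
      rw [hcast]
      have hsum : ∑ j ∈ J, m j ≤ J.card := by
        refine (Finset.sum_le_sum fun l _ => hm1 l).trans ?_
        simp
      -- The loss at generation `k` is `2 / 2 ^ k`, which fixes the form of `q` in terms of `k₀ ≤
      -- k`.
      have hqk : q ≤ 1 - 4 / 2 ^ (k + 1) := by
        have e : (4 : ℝ) / 2 ^ (k + 1) = 2 / 2 ^ k := by rw [pow_succ]; field_simp; norm_num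
        rw [e, hq]
        have : (2 : ℝ) / 2 ^ k ≤ 2 / 2 ^ k₀ := by
          gcongr
          exact one_le_two
        linarith
      calc 2 * π * q * (ρ * ∑ j ∈ J, m j) ≤ 2 * π * (1 - 4 / 2 ^ (k + 1)) * (ρ * J.card) := by
            refine mul_le_mul (by gcongr) (by gcongr)
              (mul_nonneg hρ.le (Finset.sum_nonneg fun j _ => hm0 j))
              (mul_nonneg (by positivity) (hq0.trans hqk))
        _ = _ := by rw [← hrρ]; ring

/-! ### The Hausdorff measure -/

lemma exists_radius_lt (m : ℕ) {ε : ℝ} (hε : 0 < ε) : ∃ n ≥ m, radius (n + 1) < ε :=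
  ((Filter.eventually_ge_atTop m).and (tendsto_radius.eventually (gt_mem_nhds hε))).exists

lemma closedBall_subset_level {n : ℕ} {x : ℂ} (hx : x ∈ desc 0 1 n) :
    closedBall x (radius (1 + n)) ⊆ level (n + 1) := by
  rw [level_succ, add_comm 1 n]
  exact subset_iUnion₂ (s := fun c _ => closedBall c (radius (n + 1))) x hx

lemma card_desc_mul_radius_le_one (n : ℕ) : (desc 0 1 n).card * radius (n + 1) ≤ 1 := by
  have := card_desc_mul_radius_le le_rfl 0 n
  rwa [add_comm 1 n] at this

lemma mass_zero_one_le_hullPerimeter {k₀ : ℕ} (hk₀ : 3 ≤ k₀) (d : ℕ) {A : Set ℂ}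
    (hA : IsBounded A) (hdiam : diam A < radius k₀) :
    2 * π * (1 - 2 / 2 ^ k₀) * mass A 0 1 d ≤ hullPerimeter A := by
  simpa [radius] using mass_le_hullPerimeter hk₀ d hA hdiam 0 le_rfl

/-- A bound that loses the factor `1 - 2 / 2 ^ k` for all large `k` holds without loss. -/
lemma ofReal_le_of_forall_ge_three {a : ℝ} {x : ℝ≥0∞}
    (h : ∀ k : ℕ, 3 ≤ k → ENNReal.ofReal (a * (1 - 2 / 2 ^ k)) ≤ x) : ENNReal.ofReal a ≤ x := by
  have h1 : Filter.Tendsto (fun k : ℕ => (2 : ℝ) / 2 ^ k) Filter.atTop (nhds 0) :=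
    tendsto_const_nhds.div_atTop (tendsto_pow_atTop_atTop_of_one_lt one_lt_two)
  have h2 := ENNReal.tendsto_ofReal ((h1.const_sub 1).const_mul a)
  rw [sub_zero, mul_one] at h2
  exact le_of_tendsto h2 ((Filter.eventually_ge_atTop 3).mono h)

lemma hausdorffMeasure_circlesOfBalls_le : μH[1] circlesOfBalls ≤ 2 := by
  have hdiam : ∀ (n : ℕ) (c : desc 0 1 n),
      ediam (closedBall (c : ℂ) (radius (n + 1))) ≤ 2 * ENNReal.ofReal (radius (n + 1)) := by
    intro n c
    rw [← closedEBall_ofReal (radius_pos _).le]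
    exact ediam_closedEBall_le
  have htend : Filter.Tendsto (fun n => 2 * ENNReal.ofReal (radius (n + 1))) Filter.atTop
      (nhds 0) := by
    have := ENNReal.Tendsto.const_mul (a := 2) (ENNReal.tendsto_ofReal tendsto_radius)
      (Or.inr (by simp))
    simpa using this
  have h := Measure.hausdorffMeasure_le_liminf_sum (ι := fun n => desc 0 1 n) 1 circlesOfBalls _
    htend (fun n c => closedBall (c : ℂ) (radius (n + 1))) (.of_forall hdiam)
    (.of_forall fun n => by
      refine (circlesOfBalls_subset_level n).trans ?_
      rw [level_succ]
      intro x hx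
      obtain ⟨c, hc, hxc⟩ := mem_iUnion₂.1 hx
      exact mem_iUnion.2 ⟨⟨c, hc⟩, hxc⟩)
  refine h.trans ?_
  calc _ ≤ Filter.liminf (fun _ : ℕ => (2 : ℝ≥0∞)) Filter.atTop := by
        refine Filter.liminf_le_liminf (.of_forall fun n => ?_)
        calc ∑ c : desc 0 1 n, ediam (closedBall (c : ℂ) (radius (n + 1))) ^ (1 : ℝ)
            ≤ ∑ _c : desc 0 1 n, 2 * ENNReal.ofReal (radius (n + 1)) :=
              Finset.sum_le_sum fun c _ => by rw [ENNReal.rpow_one]; exact hdiam n c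
          _ = 2 * ENNReal.ofReal ((desc 0 1 n).card * radius (n + 1)) := by
              rw [Finset.sum_const, Finset.card_univ, Fintype.card_coe, nsmul_eq_mul,
                ENNReal.ofReal_mul (by positivity), ENNReal.ofReal_natCast]
              ring
          _ ≤ 2 * 1 := by
              gcongr
              rw [ENNReal.ofReal_le_one]
              exact card_desc_mul_radius_le_one n
          _ = 2 := mul_one 2
    _ = 2 := Filter.liminf_const 2

lemma le_hausdorffMeasure_circlesOfBalls : 2 ≤ μH[1] circlesOfBalls := by
  classical
  rw [show (2 : ℝ≥0∞) = ENNReal.ofReal 2 by norm_num]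
  refine ofReal_le_of_forall_ge_three fun k₀ hk₀ => ?_
  have hr := radius_pos k₀
  -- Covering sets of diameter at most `δ₀` are enlarged by at most `δ₀` more in diameter, which
  -- stays below `radius k₀`.
  let δ₀ : NNReal := ⟨radius k₀ / 4, by positivity⟩
  have hδ₀ : (0 : NNReal) < δ₀ := by
    rw [← NNReal.coe_pos]; change 0 < radius k₀ / 4; positivity
  rw [Measure.hausdorffMeasure_apply]
  refine le_iSup₂_of_le (δ₀ : ℝ≥0∞) (by exact_mod_cast hδ₀) (le_iInf fun t => le_iInf fun hKt =>
    le_iInf fun ht => ?_)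
  apply ENNReal.le_of_forall_pos_le_add
  intro ε hε _
  have hε' : ((min ε δ₀ : NNReal) : ℝ≥0∞) ≠ 0 := by
    rw [Ne, ENNReal.coe_eq_zero]; exact (lt_min hε hδ₀).ne'
  obtain ⟨η, hη, hηsum⟩ := ENNReal.exists_pos_sum_of_countable hε' ℕ
  -- Open sets are needed for compactness. Thickening by `η i / 2` costs `η i` in diameter, hence
  -- less than `ε` in total.
  let O : ℕ → Set ℂ := fun i => thickening ((η i / 2 : NNReal) : ℝ) (t i)
  have hOdiam : ∀ i, ediam (O i) ≤ ediam (t i) + η i := fun i => by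
    refine (ediam_thickening_le _).trans (le_of_eq ?_)
    congr 1
    rw [ENNReal.coe_div two_ne_zero]
    exact ENNReal.mul_div_cancel two_ne_zero (by simp)
  have hηi : ∀ i, (η i : ℝ≥0∞) ≤ δ₀ := fun i =>
    (ENNReal.le_tsum i).trans (hηsum.le.trans (by exact_mod_cast min_le_right _ _))
  have hOdiam' : ∀ i, ediam (O i) ≤ ((δ₀ + δ₀ : NNReal) : ℝ≥0∞) := fun i => by
    push_cast
    exact (hOdiam i).trans (add_le_add (ht i) (hηi i))
  have hOb : ∀ i, IsBounded (O i) := fun i =>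
    isBounded_iff_ediam_ne_top.2 (ne_top_of_le_ne_top ENNReal.coe_ne_top (hOdiam' i))
  have hOd : ∀ i, diam (O i) < radius k₀ := fun i => by
    have := ENNReal.toReal_mono ENNReal.coe_ne_top (hOdiam' i)
    have e : ((δ₀ + δ₀ : NNReal) : ℝ≥0∞).toReal = radius k₀ / 4 + radius k₀ / 4 := rfl
    rw [e] at this
    change diam (O i) ≤ _ at this
    linarith
  have hKO : circlesOfBalls ⊆ ⋃ i, O i := hKt.trans (iUnion_mono fun i =>
    self_subset_thickening (by have := hη i; positivity) _)
  obtain ⟨m, hm⟩ := exists_level_subset (isOpen_iUnion fun i => isOpen_thickening) hKO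
  -- A Lebesgue number makes every ball of a deep level lie in a single `O i`, as the mass requires.
  obtain ⟨δ, hδ, hleb⟩ := lebesgue_number_lemma_of_metric (isCompact_level m)
    (fun i => isOpen_thickening) hm
  obtain ⟨n, hmn, hn⟩ := exists_radius_lt m hδ
  have hex : ∀ x : ℂ, ∃ i, x ∈ desc 0 1 n → closedBall x (radius (1 + n)) ⊆ O i := fun x => by
    by_cases hx : x ∈ desc 0 1 n
    · obtain ⟨i, hi⟩ := hleb x (antitone_level hmn
        (closedBall_subset_level hx (mem_closedBall_self (radius_pos _).le)))
      rw [add_comm] at hn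
      exact ⟨i, fun _ => (closedBall_subset_ball hn).trans hi⟩
    · exact ⟨0, fun h => absurd h hx⟩
  choose i hi using hex
  let s := (desc 0 1 n).image i
  have hmass := one_le_sum_mass s O (c := 0) (k := 1) (d := n) fun x hx =>
    ⟨i x, Finset.mem_image_of_mem _ hx, hi x hx⟩
  have hq0 := one_sub_two_div_pow_nonneg (k := k₀) (by omega)
  have hreal : 2 * (1 - 2 / 2 ^ k₀) ≤ ∑ i ∈ s, diam (O i) := by
    have h1 : 2 * π * (1 - 2 / 2 ^ k₀) * 1 ≤ π * ∑ i ∈ s, diam (O i) :=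
      calc 2 * π * (1 - 2 / 2 ^ k₀) * 1
          ≤ 2 * π * (1 - 2 / 2 ^ k₀) * ∑ i ∈ s, mass (O i) 0 1 n := by gcongr
        _ = ∑ i ∈ s, 2 * π * (1 - 2 / 2 ^ k₀) * mass (O i) 0 1 n := Finset.mul_sum _ _ _
        _ ≤ ∑ i ∈ s, π * diam (O i) := Finset.sum_le_sum fun i _ =>
          (mass_zero_one_le_hullPerimeter hk₀ n (hOb i) (hOd i)).trans
            (hullPerimeter_le_pi_mul_diam (hOb i))
        _ = _ := (Finset.mul_sum _ _ _).symm
    have h2 : π * (2 * (1 - 2 / 2 ^ k₀)) ≤ π * ∑ i ∈ s, diam (O i) := by linarith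
    exact le_of_mul_le_mul_left h2 Real.pi_pos
  calc ENNReal.ofReal (2 * (1 - 2 / 2 ^ k₀)) ≤ ENNReal.ofReal (∑ i ∈ s, diam (O i)) :=
        ENNReal.ofReal_le_ofReal hreal
    _ = ∑ i ∈ s, ediam (O i) := by
        rw [ENNReal.ofReal_sum_of_nonneg fun _ _ => diam_nonneg]
        exact Finset.sum_congr rfl fun i _ => ENNReal.ofReal_toReal (hOb i).ediam_ne_top
    _ ≤ ∑ i ∈ s, ((⨆ _ : (t i).Nonempty, ediam (t i) ^ (1 : ℝ)) + η i) := by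
        refine Finset.sum_le_sum fun i _ => ?_
        rcases (t i).eq_empty_or_nonempty with h | h
        · simp [O, h]
        · rw [ciSup_pos h, ENNReal.rpow_one]
          exact hOdiam i
    _ ≤ ∑' i, ((⨆ _ : (t i).Nonempty, ediam (t i) ^ (1 : ℝ)) + η i) := ENNReal.sum_le_tsum s
    _ = _ := ENNReal.tsum_add
    _ ≤ _ := by
        gcongr
        exact hηsum.le.trans (by exact_mod_cast min_le_left _ _)

/-! ### The lower bound for the Painlevé length -/

lemma le_kappa_circlesOfBalls : ENNReal.ofReal (2 * π) ≤ kappa circlesOfBalls := by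
  refine le_sInf fun l hl => ofReal_le_of_forall_ge_three fun k₀ hk₀ => ?_
  have hρ := radius_pos (k₀ + 1)
  set ρ := radius (k₀ + 1) with hρdef
  let I : Set ℂ := desc 0 1 k₀
  -- Any factor strictly between `1` and `3 / 2` contains the level in the open discs and keeps the
  -- closed discs disjoint. Each connected boundary curve is then confined to one small disc.
  let W : ℂ → Set ℂ := fun c => closedBall c (5 / 4 * ρ)
  have hWd : I.PairwiseDisjoint W := by
    have := pairwiseDisjoint_closedBall_desc le_rfl 0 k₀ (l := 5 / 4) (by norm_num) (by norm_num)
    rwa [add_comm 1 k₀] at this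
  obtain ⟨V, hV, hKV, hVU, n, γ, hγ, -, hfr, hlen⟩ := hl (⋃ c ∈ I, ball c (5 / 4 * ρ))
    (isOpen_biUnion fun _ _ => isOpen_ball) ((circlesOfBalls_subset_level k₀).trans (by
      rw [level_succ]
      exact iUnion₂_mono fun c _ => closedBall_subset_ball (by linarith)))
  have hUW : closure V ⊆ ⋃ c ∈ I, W c :=
    closure_minimal (hVU.trans (iUnion₂_mono fun c _ => ball_subset_closedBall))
      (isClosed_biUnion_finset fun c _ => isClosed_closedBall)
  have hVb : IsBounded V := ((isBounded_biUnion_finset (desc 0 1 k₀)).2 fun c _ =>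
    isBounded_closedBall).subset (subset_closure.trans hUW)
  have hγc : ∀ i, Continuous (γ i) := fun i =>
    continuousOn_univ.1 (hγ i).analytic.continuousOn
  have hGW : ∀ i, ∃ c ∈ I, range (γ i) ⊆ W c := fun i =>
    exists_subset_of_isPreconnected (isPreconnected_range (hγc i)) (range_nonempty _)
      (desc 0 1 k₀) W (fun _ _ => isClosed_closedBall) hWd
      (((subset_iUnion (fun i => range (γ i)) i).trans hfr.symm.subset).trans
        (frontier_subset_closure.trans hUW))
  obtain ⟨s, hs, hsd, hcov, hsum⟩ := exists_disjoint_convex_cover (fun i => range (γ i))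
    (fun i => (isCompact_range_of_periodic (hγc i) (hγ i).periodic).isBounded)
    (fun i => range_nonempty _) I W (fun c _ => ⟨isClosed_closedBall, convex_closedBall _ _⟩)
    hWd hGW
  have hVs : V ⊆ ⋃ D ∈ s, id D :=
    subset_biUnion_of_frontier_subset s id (fun D hD => (hs D hD).1) (fun D hD => (hs D hD).2.1)
      (fun D hD => (hs D hD).2.2.1) hsd hV hVb (hfr ▸ iUnion_subset hcov)
  obtain ⟨m, hm⟩ := exists_level_subset hV hKV
  -- A construction ball inside `V` is connected, so it lies in one of the disjoint convex sets.
  have hmass := one_le_sum_mass s id (c := 0) (k := 1) (d := m) fun x hx =>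
    exists_subset_of_isPreconnected (convex_closedBall x (radius (1 + m))).isPreconnected
      ⟨x, mem_closedBall_self (radius_pos _).le⟩ s id (fun D hD => (hs D hD).1.isClosed) hsd
      ((closedBall_subset_level hx).trans (hm.trans hVs))
  have hdiam : ∀ D ∈ s, diam D < radius k₀ := fun D hD => by
    obtain ⟨c, -, hDc⟩ := (hs D hD).2.2.2
    have h1 := diam_mono hDc isBounded_closedBall
    have h2 : diam (W c) ≤ 2 * (5 / 4 * ρ) := diam_closedBall (by positivity)
    have h3 := radius_eq_pow_mul (k := k₀) (by omega)
    have h4 : (16 : ℝ) ≤ 2 ^ (k₀ + 1) := by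
      calc (16 : ℝ) = 2 ^ 4 := by norm_num
        _ ≤ _ := pow_le_pow_right₀ one_le_two (by omega)
    rw [← hρdef] at h3
    nlinarith
  have hq0 := one_sub_two_div_pow_nonneg (k := k₀) (by omega)
  have hreal : 2 * π * (1 - 2 / 2 ^ k₀) ≤ ∑ i, hullPerimeter (range (γ i)) :=
    calc 2 * π * (1 - 2 / 2 ^ k₀) = 2 * π * (1 - 2 / 2 ^ k₀) * 1 := (mul_one _).symm
      _ ≤ 2 * π * (1 - 2 / 2 ^ k₀) * ∑ D ∈ s, mass (id D) 0 1 m := by gcongr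
      _ = ∑ D ∈ s, 2 * π * (1 - 2 / 2 ^ k₀) * mass D 0 1 m := Finset.mul_sum _ _ _
      _ ≤ ∑ D ∈ s, hullPerimeter D := Finset.sum_le_sum fun D hD =>
        mass_zero_one_le_hullPerimeter hk₀ m (hs D hD).1.isBounded (hdiam D hD)
      _ ≤ _ := hsum
  calc ENNReal.ofReal (2 * π * (1 - 2 / 2 ^ k₀))
      ≤ ENNReal.ofReal (∑ i, hullPerimeter (range (γ i))) := ENNReal.ofReal_le_ofReal hreal
    _ = ∑ i, ENNReal.ofReal (hullPerimeter (range (γ i))) :=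
      ENNReal.ofReal_sum_of_nonneg fun i _ => hullPerimeter_nonneg
        (isCompact_range_of_periodic (hγc i) (hγ i).periodic).isBounded
    _ ≤ ∑ i, curveLength (γ i) := Finset.sum_le_sum fun i _ =>
      hullPerimeter_range_le_curveLength (hγc i) (hγ i).periodic
    _ ≤ l := hlen

/-! ### The upper bound for the Painlevé length -/

/-- The parametrisation of period `1` of a circle. -/
noncomputable def circle (c : ℂ) (R : ℝ) (t : ℝ) : ℂ := circleMap c R (2 * π * t)

lemma circle_eq_comp (c : ℂ) (R : ℝ) : circle c R = circleMap c R ∘ fun t => 2 * π * t := rfl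

lemma range_circle (c : ℂ) {R : ℝ} (hR : 0 ≤ R) : range (circle c R) = sphere c R := by
  have hs : Function.Surjective fun t : ℝ => 2 * π * t := fun y =>
    ⟨y / (2 * π), by simp only; field_simp⟩
  rw [circle_eq_comp, hs.range_comp, range_circleMap, abs_of_nonneg hR]

lemma isAnalyticJordanCurve_circle (c : ℂ) {R : ℝ} (hR : R ≠ 0) :
    IsAnalyticJordanCurve (circle c R) where
  analytic := by
    rw [circle_eq_comp]
    refine (analyticOnNhd_circleMap c R).comp (t := univ) ?_ (mapsTo_univ _ _)
    exact analyticOnNhd_const.mul analyticOnNhd_id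
  periodic t := by
    rw [circle, mul_add, mul_one, periodic_circleMap c R, circle]
  injOn := by
    intro s hs t ht hst
    have h := eq_of_circleMap_eq hR (by
      rw [← mul_sub, abs_mul, abs_of_pos (by positivity)]
      have : |s - t| < 1 := abs_lt.2 ⟨by linarith [hs.1, ht.2], by linarith [hs.2, ht.1]⟩
      nlinarith [Real.pi_pos]) hst
    exact mul_left_cancel₀ (by positivity) h
  regular t := by
    have h1 := (hasDerivAt_circleMap c R (2 * π * t)).scomp t
      ((hasDerivAt_id t).const_mul (2 * π))
    have h2 : deriv (circle c R) t = (2 * π * 1) • (circleMap 0 R (2 * π * t) * Complex.I) :=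
      h1.deriv
    rw [h2]
    refine smul_ne_zero (by positivity) ?_
    have := deriv_circleMap_ne_zero (c := c) (θ := 2 * π * t) hR
    rwa [deriv_circleMap] at this

lemma curveLength_circle_le (c : ℂ) {R : ℝ} (hR : 0 ≤ R) :
    curveLength (circle c R) ≤ ENNReal.ofReal (2 * π * R) := by
  have hmono : MonotoneOn (fun t : ℝ => 2 * π * t) (Icc 0 1) := fun s _ t _ hst => by
    dsimp only; gcongr
  have h1 := (hmono.eVariationOn_eq (a := 0) (b := 1) (by simp) (by simp)).le
  have h2 := ((lipschitzWith_circleMap c R).lipschitzOnWith (s := univ)).comp_eVariationOn_le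
    (g := fun t : ℝ => 2 * π * t) (s := Icc 0 1) (mapsTo_univ _ _)
  rw [inter_self] at h1
  refine h2.trans ((mul_le_mul_right h1 _).trans (le_of_eq ?_))
  have e : ((Real.nnabs R : NNReal) : ℝ≥0∞) = ENNReal.ofReal R := by
    rw [ENNReal.ofReal, Real.nnabs_of_nonneg hR]
  rw [e, ← ENNReal.ofReal_mul hR]
  congr 1; ring

/-- The boundary of a finite union of open discs whose closures are disjoint. -/
lemma frontier_biUnion_ball (s : Finset ℂ) {R : ℝ} (hR : 0 < R)
    (hd : (s : Set ℂ).PairwiseDisjoint fun c => closedBall c R) :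
    frontier (⋃ c ∈ s, ball c R) = ⋃ c ∈ s, sphere c R := by
  have ho : IsOpen (⋃ c ∈ s, ball c R) := isOpen_biUnion fun _ _ => isOpen_ball
  rw [ho.frontier_eq, s.closure_biUnion]
  ext x
  simp only [closure_ball _ hR.ne', mem_sdiff, mem_iUnion, exists_prop, not_exists, not_and]
  constructor
  · rintro ⟨⟨c, hc, hx⟩, h⟩
    refine ⟨c, hc, le_antisymm hx (not_lt.1 (h c hc))⟩
  · rintro ⟨c, hc, hx⟩
    refine ⟨⟨c, hc, sphere_subset_closedBall hx⟩, fun c' hc' hx' => ?_⟩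
    by_cases hcc : c = c'
    · subst hcc
      exact (mem_ball.1 hx').ne (mem_sphere.1 hx)
    · exact disjoint_left.1 (hd hc hc' hcc) (sphere_subset_closedBall hx)
        (ball_subset_closedBall hx')

lemma kappa_circlesOfBalls_le : kappa circlesOfBalls ≤ ENNReal.ofReal (2 * π) := by
  have key : ∀ ε : ℝ, 0 < ε → kappa circlesOfBalls ≤ ENNReal.ofReal (2 * π * (1 + ε)) := by
    intro ε hε
    refine sInf_le fun U hU hKU => ?_
    obtain ⟨m, hm⟩ := exists_level_subset hU hKU
    obtain ⟨δ, hδ, hδU⟩ := (isCompact_level m).exists_thickening_subset_open hU hm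
    have hr := radius_pos (m + 1)
    have hr1 : radius (m + 1) ≤ 1 := radius_antitone le_rfl (by omega)
    -- The three bounds control the length, keep the enlarged discs disjoint (`1 + η < 3 / 2`), and
    -- keep them inside `U`.
    let η := min ε (min (1 / 4) (δ / 2))
    have hη0 : 0 < η := lt_min hε (lt_min (by norm_num) (by positivity))
    have hη1 : η ≤ ε := min_le_left _ _
    have hη2 : η ≤ 1 / 4 := (min_le_right _ _).trans (min_le_left _ _)
    have hη3 : η ≤ δ / 2 := (min_le_right _ _).trans (min_le_right _ _)
    let R := (1 + η) * radius (m + 1)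
    have hR : 0 < R := by positivity
    have hrR : radius (m + 1) < R := by simp only [R]; nlinarith
    have hd : (desc 0 1 m : Set ℂ).PairwiseDisjoint fun c => closedBall c R := by
      have := pairwiseDisjoint_closedBall_desc le_rfl 0 m (l := 1 + η) (by linarith) (by linarith)
      rwa [add_comm 1 m] at this
    let e := (desc 0 1 m).equivFin.symm
    refine ⟨⋃ c ∈ desc 0 1 m, ball c R, isOpen_biUnion fun _ _ => isOpen_ball, ?_, ?_,
      (desc 0 1 m).card, fun i => circle (e i) R, fun i => isAnalyticJordanCurve_circle _ hR.ne',
      fun i j hij => ?_, ?_, ?_⟩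
    · refine (circlesOfBalls_subset_level m).trans ?_
      rw [level_succ]
      exact iUnion₂_mono fun c _ => closedBall_subset_ball hrR
    · refine subset_trans (iUnion₂_subset fun c hc => ?_) hδU
      have hlt : R < δ + radius (m + 1) := by simp only [R]; nlinarith
      calc ball c R ⊆ ball c (δ + radius (m + 1)) := ball_subset_ball hlt.le
        _ = thickening δ (closedBall c (radius (m + 1))) := (thickening_closedBall hδ hr.le c).symm
        _ ⊆ _ := thickening_subset_of_subset δ (by
          have := closedBall_subset_level hc
          rwa [add_comm 1 m] at this)
    · rw [range_circle _ hR.le, range_circle _ hR.le]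
      refine Disjoint.mono sphere_subset_closedBall sphere_subset_closedBall
        (hd (e i).2 (e j).2 fun h => hij (e.injective (Subtype.ext h)))
    · rw [frontier_biUnion_ball _ hR hd]
      ext x
      simp only [range_circle _ hR.le, mem_iUnion, exists_prop]
      constructor
      · rintro ⟨c, hc, hx⟩
        exact ⟨e.symm ⟨c, hc⟩, by simpa using hx⟩
      · rintro ⟨i, hx⟩
        exact ⟨e i, (e i).2, hx⟩
    · calc ∑ i, curveLength (circle (e i) R)
          ≤ ∑ _i : Fin (desc 0 1 m).card, ENNReal.ofReal (2 * π * R) :=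
            Finset.sum_le_sum fun i _ => curveLength_circle_le _ hR.le
        _ = ENNReal.ofReal ((desc 0 1 m).card * (2 * π * R)) := by
            rw [Finset.sum_const, Finset.card_univ, Fintype.card_fin, nsmul_eq_mul,
              ENNReal.ofReal_mul (p := ((desc 0 1 m).card : ℝ)) (by positivity),
              ENNReal.ofReal_natCast]
        _ ≤ _ := by
            apply ENNReal.ofReal_le_ofReal
            have h1 := card_desc_mul_radius_le_one m
            calc ((desc 0 1 m).card : ℝ) * (2 * π * R)
                = 2 * π * (1 + η) * ((desc 0 1 m).card * radius (m + 1)) := by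
                  simp only [R]; ring
              _ ≤ 2 * π * (1 + η) * 1 := by gcongr
              _ ≤ _ := by rw [mul_one]; gcongr
  have htend : Filter.Tendsto (fun n : ℕ => ENNReal.ofReal (2 * π * (1 + 1 / ((n : ℝ) + 1))))
      Filter.atTop (nhds (ENNReal.ofReal (2 * π * (1 + 0)))) :=
    ENNReal.tendsto_ofReal ((tendsto_one_div_add_atTop_nhds_zero_nat.const_add 1).const_mul _)
  rw [add_zero, mul_one] at htend
  exact ge_of_tendsto' htend fun n => key _ (by positivity)

end Painleve

/-! ### The theorem -/

theorem mainTheorem4 :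
    (∀ k : ℕ, 1 ≤ k → Painleve.level (k + 1) ⊆ Painleve.level k) ∧
    IsCompact Painleve.circlesOfBalls ∧
    IsTotallyDisconnected Painleve.circlesOfBalls ∧
    μH[1] Painleve.circlesOfBalls = 2 ∧
    Painleve.kappa Painleve.circlesOfBalls = ENNReal.ofReal (2 * π) ∧
    Painleve.kappa Painleve.circlesOfBalls =
      ENNReal.ofReal π * μH[1] Painleve.circlesOfBalls ∧
    (∀ c : ℝ≥0∞,
      (∀ E : Set ℂ, IsCompact E → Painleve.kappa E ≤ c * μH[1] E) → ENNReal.ofReal π ≤ c) := by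
  have hμ : μH[1] Painleve.circlesOfBalls = 2 :=
    le_antisymm Painleve.hausdorffMeasure_circlesOfBalls_le
      Painleve.le_hausdorffMeasure_circlesOfBalls
  have hκ : Painleve.kappa Painleve.circlesOfBalls = ENNReal.ofReal (2 * π) :=
    le_antisymm Painleve.kappa_circlesOfBalls_le Painleve.le_kappa_circlesOfBalls
  have hπ : ENNReal.ofReal (2 * π) = ENNReal.ofReal π * 2 := by
    rw [mul_comm, ENNReal.ofReal_mul Real.pi_pos.le, ENNReal.ofReal_ofNat]
  refine ⟨fun k hk => ?_, Painleve.isCompact_circlesOfBalls,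
    Painleve.isTotallyDisconnected_circlesOfBalls, hμ, hκ, by rw [hκ, hμ, hπ], fun c hc => ?_⟩
  · obtain ⟨d, rfl⟩ := Nat.exists_eq_add_of_le' hk
    exact Painleve.level_succ_subset d
  · have h := hc _ Painleve.isCompact_circlesOfBalls
    rw [hκ, hμ, hπ] at h
    exact (ENNReal.mul_le_mul_iff_left two_ne_zero (by simp)).1 h
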